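/- Let $p\in(0,1)$ be a constant and, for each $n\ge 1$, let $G_p$ be a random graph on $n$ labelled vertices in which each of the $\binom n2$ possible edges is present independently with probability $p$. For a graph $G$ let $D(i,j)$ be the distance between the vertices $i$ and $j$, and let $HW(G)$ be the hyper-Wiener matrix of $G$, the real symmetric matrix with entries $$HW(G)(i,j)=\tfrac12\bigl(D(i,j)+D(i,j)^2\bigr)$$ (entries for vertices in different components are set to $0$; in particular $HW(G)(i,i)=0$ because $D(i,i)=0$). Let $\mathscr E(HW(G))=\sum_{k=1}^n|\lambda_k|$ be its energy, where $\lambda_1,\dots,\lambda_n$ are the eigenvalues of $HW(G)$ with multiplicity. Then, with probability tending to $1$ as $n\to\infty$, $$\mathscr E(HW(G_p))=\Bigl(\frac{16}{3\pi}\sqrt{p(1-p)}+o(1)\Bigr)n^{3/2};$$ that is, for every $\varepsilon>0$, $$\lim_{n\to\infty}\mathbb P\Bigl(\Bigl|\mathscr E(HW(G_p))-\frac{16}{3\pi}\sqrt{p(1-p)}\;n^{3/2}\Bigr|\le\varepsilon\, n^{3/2}\Bigr)=1.$$ -/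

import Mathlib

open MeasureTheory Filter Topology

noncomputable section

namespace HyperWiener

/-- The energy of a real symmetric matrix: the sum of the absolute values of its eigenvalues,
counted with multiplicity. -/
def energy {V : Type*} [Fintype V] [DecidableEq V] (A : Matrix V V ℝ) (hA : A.IsHermitian) : ℝ :=
  ∑ i, |hA.eigenvalues i|

/-- The hyper-Wiener matrix of a graph, with entries `(D(i,j) + D(i,j)²) / 2`, where `D` is the
graph distance. The diagonal is zero. Mathlib's `dist` of two vertices that are not joined by a
walk is `0`, so the corresponding entries are `0`. -/
def hyperWienerMatrix {V : Type*} (G : SimpleGraph V) : Matrix V V ℝ :=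
  Matrix.of fun i j => ((G.dist i j : ℝ) + (G.dist i j : ℝ) ^ 2) / 2

theorem hyperWienerMatrix_isHermitian {V : Type*} (G : SimpleGraph V) :
    (hyperWienerMatrix G).IsHermitian := by
  ext i j
  simp [hyperWienerMatrix, SimpleGraph.dist_comm (u := j) (v := i)]

/-- The energy of the hyper-Wiener matrix of a finite graph. -/
def hyperWienerEnergy {V : Type*} [Fintype V] [DecidableEq V] (G : SimpleGraph V) : ℝ :=
  energy (hyperWienerMatrix G) (hyperWienerMatrix_isHermitian G)

end HyperWiener

end

/-! With probability tending to 1 any two distinct vertices have a common neighbour. All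
off-diagonal distances are then 1 or 2, the matrix entries are 1 or 3, and HW = -2√n X + (3 - 2p)(J
- I), where X is the adjacency matrix centred by p and scaled by 1/√n (`hyperWienerMatrix_eq`). The
trace norm of J - I is at most 2n, negligible against n^(3/2), so it remains to show that the energy
of X divided by n tends to 8/(3π) √v in mean, where v = p(1 - p).

Coulson's formula |λ| = (2/π) ∫₀^∞ λ²/(λ² + t²) dt expresses this energy through the Stieltjes
transform s of X on the imaginary axis alone, because the average of λ²/(λ² + t²) is 1 - t Im s(it).
The semicircle law enters only through its quadratic equation: the defect F = it s + 1 + v s² is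
small. Resampling one edge gives an exact integration by parts for the entries of X. Applying it to
E[F F̄], with F̄ carried along as part of the test function, bounds E|F|² by a constant depending on
t over √n (`mean_norm_loopDefect_sq_le`), so no separate concentration inequality is needed. Since
Im s ≥ 0, the quadratic is stable and s is close to the root in the upper half plane
(`abs_stieltjes_im_sub_le`).

The bound 2/(1 + t²), uniform in n and in the graph, allows dominated convergence in t. The limiting
integral is (4/3)√v, and Markov's inequality gives the convergence in probability. -/

noncomputable section

namespace HyperWiener

open SimpleGraph

/-! ### Expectations over the random graph and resampling of one edge -/

section RandomGraph

variable {V : Type*} [Fintype V] [DecidableEq V]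
variable {E : Type*} [AddCommGroup E] [Module ℝ E]

/-- The probability of the graph `G` when edges are present independently with probability `p`. -/
def graphWeight (p : ℝ) (G : SimpleGraph V) : ℝ :=
  p ^ G.edgeSet.ncard * (1 - p) ^ ((Fintype.card V).choose 2 - G.edgeSet.ncard)

/-- The expectation of `f` over the binomial random graph. -/
def mean (p : ℝ) (f : SimpleGraph V → E) : E := ∑ G, graphWeight p G • f G

omit [DecidableEq V] in
theorem graphWeight_nonneg {p : ℝ} (h0 : 0 ≤ p) (h1 : p ≤ 1) (G : SimpleGraph V) :
    0 ≤ graphWeight p G :=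
  mul_nonneg (pow_nonneg h0 _) (pow_nonneg (sub_nonneg.2 h1) _)

/-- The common factor `c` is the weight of all the other pairs; naming it avoids dividing by `p` or
`1 - p`. -/
theorem exists_graphWeight_sup_edge (p : ℝ) {G : SimpleGraph V} {i j : V} (hij : i ≠ j)
    (h : ¬ G.Adj i j) :
    ∃ c, graphWeight p (G ⊔ edge i j) = p * c ∧ graphWeight p G = (1 - p) * c := by
  classical
  have h1 : (G ⊔ edge i j).edgeSet.ncard = G.edgeSet.ncard + 1 := by
    rw [edgeSet_sup, edgeSet_edge_of_ne hij, Set.union_singleton,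
      Set.ncard_insert_of_notMem (by simpa using h) (Set.toFinite _)]
  -- This keeps the truncated subtraction in the exponent of `1 - p` exact.
  have h2 : (G ⊔ edge i j).edgeSet.ncard ≤ (Fintype.card V).choose 2 := by
    have := (G ⊔ edge i j).card_edgeFinset_le_card_choose_two
    rwa [← Set.ncard_coe_finset, coe_edgeFinset] at this
  refine ⟨p ^ G.edgeSet.ncard *
    (1 - p) ^ ((Fintype.card V).choose 2 - (G.edgeSet.ncard + 1)), ?_, ?_⟩
  · rw [graphWeight, h1]; ring
  · rw [graphWeight, show (Fintype.card V).choose 2 - G.edgeSet.ncard =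
      (Fintype.card V).choose 2 - (G.edgeSet.ncard + 1) + 1 by omega]
    ring

omit [Module ℝ E] in
open Classical in
theorem sum_eq_sum_not_adj {i j : V} (hij : i ≠ j) (g : SimpleGraph V → E) :
    ∑ G, g G = ∑ G with ¬ G.Adj i j, (g (G ⊔ edge i j) + g G) := by
  rw [← Finset.sum_filter_add_sum_filter_not Finset.univ (fun G : SimpleGraph V => G.Adj i j),
    Finset.sum_add_distrib]
  congr 1
  refine Finset.sum_nbij' (fun G => G \ edge i j) (fun G => G ⊔ edge i j) ?_ ?_ ?_ ?_ ?_
  · intro G _; simp [edge_adj, hij]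
  · intro G _; simp [edge_adj, hij]
  · intro G hG
    have : edge i j ≤ G := (edge_le_iff G).2 (Or.inr (by simpa using hG))
    simp [this]
  · intro G hG
    have : ¬ G.Adj i j := by simpa using hG
    simp [sdiff_edge G this]
  · intro G hG
    have : edge i j ≤ G := (edge_le_iff G).2 (Or.inr (by simpa using hG))
    simp [this]

theorem mean_add (p : ℝ) (f g : SimpleGraph V → E) :
    mean p (fun G => f G + g G) = mean p f + mean p g := by
  simp [mean, Finset.sum_add_distrib]

theorem mean_smul {R : Type*} [Semiring R] [Module R E] [SMulCommClass ℝ R E] (p : ℝ) (c : R)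
    (f : SimpleGraph V → E) : mean p (fun G => c • f G) = c • mean p f := by
  simp only [mean, Finset.smul_sum, smul_comm]

theorem mean_sum {ι : Type*} (p : ℝ) (s : Finset ι) (f : ι → SimpleGraph V → E) :
    mean p (fun G => ∑ i ∈ s, f i G) = ∑ i ∈ s, mean p (f i) := by
  simp only [mean, Finset.smul_sum]
  exact Finset.sum_comm

/-- Resampling a single edge does not change expectations. -/
theorem mean_resample (p : ℝ) {i j : V} (hij : i ≠ j) (f : SimpleGraph V → E) :
    mean p f = mean p (fun G => p • f (G ⊔ edge i j) + (1 - p) • f (G \ edge i j)) := by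
  classical
  rw [mean, mean, sum_eq_sum_not_adj hij, sum_eq_sum_not_adj hij]
  refine Finset.sum_congr rfl fun G hG => ?_
  have hG : ¬ G.Adj i j := by simpa using hG
  obtain ⟨c, h1, h2⟩ := exists_graphWeight_sup_edge p hij hG
  have h3 : (G ⊔ edge i j) \ edge i j = G := by
    rw [sup_sdiff_right_self, sdiff_edge G hG]
  rw [h1, h2, h3, sup_assoc, sup_idem, sdiff_edge G hG]
  module

theorem mean_mono {p : ℝ} (h0 : 0 ≤ p) (h1 : p ≤ 1) {f g : SimpleGraph V → ℝ}
    (h : ∀ G, f G ≤ g G) : mean p f ≤ mean p g :=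
  Finset.sum_le_sum fun G _ => mul_le_mul_of_nonneg_left (h G) (graphWeight_nonneg h0 h1 G)

theorem mean_nonneg {p : ℝ} (h0 : 0 ≤ p) (h1 : p ≤ 1) {f : SimpleGraph V → ℝ}
    (h : ∀ G, 0 ≤ f G) : 0 ≤ mean p f :=
  Finset.sum_nonneg fun G _ => mul_nonneg (graphWeight_nonneg h0 h1 G) (h G)

theorem norm_mean_le {F : Type*} [NormedAddCommGroup F] [NormedSpace ℝ F] {p : ℝ} (h0 : 0 ≤ p)
    (h1 : p ≤ 1) (f : SimpleGraph V → F) : ‖mean p f‖ ≤ mean p (fun G => ‖f G‖) := by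
  refine (norm_sum_le _ _).trans (Finset.sum_le_sum fun G _ => ?_)
  rw [norm_smul, Real.norm_of_nonneg (graphWeight_nonneg h0 h1 G), smul_eq_mul]

omit [DecidableEq V] in
theorem binomialRandom_real_singleton (p : unitInterval) (G : SimpleGraph V) :
    (binomialRandom V p).real {G} = graphWeight p G := by
  rw [measureReal_def, binomialRandom_singleton, graphWeight, Nat.card_eq_fintype_card]
  simp

theorem binomialRandom_real_eq_mean (p : unitInterval) (S : Set (SimpleGraph V)) :
    (binomialRandom V p).real S = mean (p : ℝ) (S.indicator fun _ => (1 : ℝ)) := by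
  classical
  -- Every event is measurable, being the preimage under `edgeSet` of a finite set.
  have hs : ∀ T : Set (SimpleGraph V), MeasurableSet T := fun T => by
    rw [← Set.preimage_image_eq T edgeSet_injective]
    exact measurable_edgeSet (Set.toFinite _).measurableSet
  have : MeasurableSingletonClass (SimpleGraph V) := ⟨fun G => hs _⟩
  rw [mean, ← S.toFinite.coe_toFinset, ← sum_measureReal_singleton, ← Finset.sum_subset
    (Finset.subset_univ S.toFinite.toFinset)]
  · refine Finset.sum_congr rfl fun G hG => ?_
    rw [binomialRandom_real_singleton, Set.indicator_of_mem (by simpa using hG)]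
    simp
  · intro G _ hG
    rw [Set.indicator_of_notMem (by simpa using hG), smul_zero]

theorem sum_graphWeight (p : unitInterval) : ∑ G : SimpleGraph V, graphWeight (p : ℝ) G = 1 := by
  have := binomialRandom_real_eq_mean (V := V) p Set.univ
  simpa [mean] using this.symm

theorem mean_const (p : unitInterval) (c : E) :
    mean (p : ℝ) (fun _ : SimpleGraph V => c) = c := by
  rw [mean, ← Finset.sum_smul, sum_graphWeight, one_smul]

/-- Different `k` involve disjoint pairs of edges. Independence is obtained by induction: resampling
`ik` turns the new factor into 1 - p·1[jk], and resampling `jk` turns that into 1 - p², while the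
remaining product is unaffected. -/
theorem mean_prod_no_common_neighbor (p : unitInterval) {i j : V} (hij : i ≠ j) (S : Finset V)
    (hi : i ∉ S) (hj : j ∉ S) :
    mean (p : ℝ) (fun G => ∏ k ∈ S, {G : SimpleGraph V | ¬ (G.Adj i k ∧ G.Adj j k)}.indicator
      (fun _ => (1 : ℝ)) G) = (1 - (p : ℝ) ^ 2) ^ S.card := by
  classical
  induction S using Finset.induction_on with
  | empty => simp [mean_const]
  | insert k S hk ih =>
    simp only [Finset.mem_insert, not_or] at hi hj
    rw [Finset.card_insert_of_notMem hk, pow_succ, ← ih hi.2 hj.2]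
    set g : SimpleGraph V → ℝ := fun G => ∏ k ∈ S,
      {G : SimpleGraph V | ¬ (G.Adj i k ∧ G.Adj j k)}.indicator (fun _ => (1 : ℝ)) G with hg
    have key : ∀ G H : SimpleGraph V, (∀ l ∈ S, (G.Adj i l ↔ H.Adj i l) ∧ (G.Adj j l ↔ H.Adj j l)) →
        g G = g H := by
      intro G H h
      refine Finset.prod_congr rfl fun l hl => ?_
      simp only [Set.indicator, Set.mem_ofPred_eq, (h l hl).1, (h l hl).2]
    have hmem : ∀ l ∈ S, l ≠ k ∧ l ≠ i ∧ l ≠ j := fun l hl =>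
      ⟨fun h => hk (h ▸ hl), fun h => hi.2 (h ▸ hl), fun h => hj.2 (h ▸ hl)⟩
    have hinv : ∀ a ∈ ({i, j} : Finset V), ∀ G, g (G ⊔ edge a k) = g G ∧ g (G \ edge a k) = g G := by
      intro a ha G
      constructor <;>
      · refine key _ _ fun l hl => ?_
        obtain ⟨h1, h2, h3⟩ := hmem l hl
        have h4 : l ≠ a := by
          rcases Finset.mem_insert.1 ha with rfl | ha
          · exact h2
          · rw [Finset.mem_singleton.1 ha]; exact h3
        simp [edge_adj, h1, h4]
    have hik : i ≠ k := hi.1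
    have hjk : j ≠ k := hj.1
    set u : SimpleGraph V → ℝ := {G : SimpleGraph V | G.Adj j k}.indicator (fun _ => (1 : ℝ)) with hu
    have hug : mean (p : ℝ) (fun G => u G * g G) = p * mean (p : ℝ) g := by
      rw [mean_resample _ hjk, ← smul_eq_mul, ← mean_smul]
      congr 1; ext G
      simp [hu, (hinv j (by simp) G).1, (hinv j (by simp) G).2, edge_adj, hjk]
    have h1 : ∀ G : SimpleGraph V, ∏ l ∈ insert k S,
        {G : SimpleGraph V | ¬ (G.Adj i l ∧ G.Adj j l)}.indicator (fun _ => (1 : ℝ)) G =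
        {G : SimpleGraph V | ¬ (G.Adj i k ∧ G.Adj j k)}.indicator (fun _ => (1 : ℝ)) G * g G :=
      fun G => Finset.prod_insert hk
    simp_rw [h1]
    rw [mean_resample _ hik]
    have h2 : ∀ G : SimpleGraph V, (p : ℝ) • ({G : SimpleGraph V | ¬ (G.Adj i k ∧ G.Adj j k)}.indicator
          (fun _ => (1 : ℝ)) (G ⊔ edge i k) * g (G ⊔ edge i k)) +
        (1 - (p : ℝ)) • ({G : SimpleGraph V | ¬ (G.Adj i k ∧ G.Adj j k)}.indicator
          (fun _ => (1 : ℝ)) (G \ edge i k) * g (G \ edge i k)) =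
        g G + (-(p : ℝ)) • (u G * g G) := by
      intro G
      rw [(hinv i (by simp) G).1, (hinv i (by simp) G).2]
      by_cases h : G.Adj j k <;> simp [hu, Set.indicator, edge_adj, hik, hij.symm, hjk, h] <;> ring
    simp_rw [h2]
    rw [mean_add, mean_smul, hug, smul_eq_mul]
    ring

end RandomGraph

/-! ### Energy as a trace norm and its stability under perturbation -/

section Energy

variable {V : Type*} [Fintype V] [DecidableEq V]

/-- The quadratic form of a real matrix. -/
def quadForm (A : Matrix V V ℝ) (x : EuclideanSpace ℝ V) : ℝ :=
  inner ℝ x (Matrix.toEuclideanLin A x)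

theorem quadForm_add (A B : Matrix V V ℝ) (x : EuclideanSpace ℝ V) :
    quadForm (A + B) x = quadForm A x + quadForm B x := by
  simp [quadForm, inner_add_right]

theorem quadForm_smul (c : ℝ) (A : Matrix V V ℝ) (x : EuclideanSpace ℝ V) :
    quadForm (c • A) x = c * quadForm A x := by
  simp [quadForm, inner_smul_right]

theorem toEuclideanLin_eigenvectorBasis {A : Matrix V V ℝ} (hA : A.IsHermitian) (k : V) :
    Matrix.toEuclideanLin A (hA.eigenvectorBasis k) =
      hA.eigenvalues k • hA.eigenvectorBasis k := by
  have := hA.mulVec_eigenvectorBasis k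
  ext a
  simpa [Matrix.toLpLin_apply] using congrFun this a

theorem quadForm_eigenvectorBasis {A : Matrix V V ℝ} (hA : A.IsHermitian) (k : V) :
    quadForm A (hA.eigenvectorBasis k) = hA.eigenvalues k := by
  rw [quadForm, toEuclideanLin_eigenvectorBasis, inner_smul_right]
  simp

theorem quadForm_eq_sum {A : Matrix V V ℝ} (hA : A.IsHermitian) (x : EuclideanSpace ℝ V) :
    quadForm A x = ∑ k, hA.eigenvalues k * inner ℝ (hA.eigenvectorBasis k) x ^ 2 := by
  rw [quadForm, ← hA.eigenvectorBasis.sum_inner_mul_inner]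
  refine Finset.sum_congr rfl fun k _ => ?_
  rw [← (Matrix.isSymmetric_toEuclideanLin_iff.mpr hA) (hA.eigenvectorBasis k) x,
    toEuclideanLin_eigenvectorBasis, real_inner_smul_left, real_inner_comm x]
  ring

/-- Each diagonal entry in the basis `b` is an average of the eigenvalues with weights the squared
inner products, and by Parseval these weights also sum to 1 over `b`. Equality holds for the
eigenbasis, so the energy is a maximum over orthonormal bases. -/
theorem sum_abs_quadForm_le_energy {A : Matrix V V ℝ} (hA : A.IsHermitian)
    (b : OrthonormalBasis V ℝ (EuclideanSpace ℝ V)) :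
    ∑ i, |quadForm A (b i)| ≤ energy A hA := by
  calc ∑ i, |quadForm A (b i)|
      ≤ ∑ i, ∑ k, |hA.eigenvalues k| * inner ℝ (hA.eigenvectorBasis k) (b i) ^ 2 := by
        refine Finset.sum_le_sum fun i _ => ?_
        rw [quadForm_eq_sum hA]
        refine (Finset.abs_sum_le_sum_abs _ _).trans (le_of_eq ?_)
        simp [abs_mul]
    _ = energy A hA := by
        rw [Finset.sum_comm, energy]
        refine Finset.sum_congr rfl fun k _ => ?_
        have := b.sum_sq_norm_inner_left (hA.eigenvectorBasis k)
        simp only [Real.norm_eq_abs, sq_abs, OrthonormalBasis.norm_eq_one, one_pow] at this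
        rw [← Finset.mul_sum, this, mul_one]

/-- Energies of matrices whose difference has small trace norm are close. -/
theorem energy_le_of_eq_smul_add {A B C : Matrix V V ℝ} (hA : A.IsHermitian) (hB : B.IsHermitian)
    {c K : ℝ} (h : A = c • B + C)
    (hC : ∀ b : OrthonormalBasis V ℝ (EuclideanSpace ℝ V), ∑ i, |quadForm C (b i)| ≤ K) :
    energy A hA ≤ |c| * energy B hB + K := by
  calc energy A hA = ∑ i, |quadForm A (hA.eigenvectorBasis i)| := by
        simp [energy, quadForm_eigenvectorBasis]
    _ ≤ ∑ i, (|c| * |quadForm B (hA.eigenvectorBasis i)| +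
          |quadForm C (hA.eigenvectorBasis i)|) := by
        refine Finset.sum_le_sum fun i _ => ?_
        have : quadForm A (hA.eigenvectorBasis i) = c * quadForm B (hA.eigenvectorBasis i) +
            quadForm C (hA.eigenvectorBasis i) := by
          rw [← quadForm_smul, ← quadForm_add, ← h]
        rw [this, ← abs_mul]
        exact abs_add_le _ _
    _ ≤ _ := by
        rw [Finset.sum_add_distrib, ← Finset.mul_sum]
        gcongr
        · exact sum_abs_quadForm_le_energy hB _
        · exact hC _

theorem abs_energy_sub_le {A B C : Matrix V V ℝ} (hA : A.IsHermitian) (hB : B.IsHermitian)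
    {c K : ℝ} (hc : c ≠ 0) (h : A = c • B + C)
    (hC : ∀ b : OrthonormalBasis V ℝ (EuclideanSpace ℝ V), ∑ i, |quadForm C (b i)| ≤ K) :
    |energy A hA - (|c| * energy B hB)| ≤ K := by
  have h1 := energy_le_of_eq_smul_add hA hB h hC
  -- The reverse inequality is the same estimate with the roles of `A` and `B` exchanged.
  have h' : B = c⁻¹ • A + (-c⁻¹) • C := by
    rw [h, smul_add, smul_smul, inv_mul_cancel₀ hc]; simp
  have h2 := energy_le_of_eq_smul_add hB hA h' (K := |c⁻¹| * K) fun b => by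
    simp_rw [quadForm_smul, abs_mul, abs_neg, ← Finset.mul_sum]
    gcongr
    exact hC b
  have h3 : |c| * energy B hB ≤ energy A hA + K := by
    calc |c| * energy B hB ≤ |c| * (|c⁻¹| * energy A hA + |c⁻¹| * K) := by gcongr
      _ = energy A hA + K := by
        rw [abs_inv]; have := abs_ne_zero.2 hc; field_simp
  rw [abs_le]; constructor <;> linarith

/-- The trace norm of a multiple of `J - I`. -/
theorem sum_abs_quadForm_allOnes_sub_one_le (c : ℝ)
    (b : OrthonormalBasis V ℝ (EuclideanSpace ℝ V)) :
    ∑ i, |quadForm (c • (Matrix.of (fun _ _ => (1 : ℝ)) - 1 : Matrix V V ℝ)) (b i)| ≤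
      |c| * (2 * Fintype.card V) := by
  -- J has rank one, with form ⟨b, 1⟩². By Parseval these squares sum to n, and the identity
  -- contributes another n.
  have h1 : ∀ i, quadForm (Matrix.of (fun _ _ => (1 : ℝ)) - 1 : Matrix V V ℝ) (b i) =
      inner ℝ (b i) (WithLp.toLp 2 fun _ => (1 : ℝ)) ^ 2 - 1 := by
    intro i
    have h2 : inner ℝ (b i) (b i) = (1 : ℝ) := by simp
    rw [sub_eq_add_neg, quadForm_add, ← neg_one_smul ℝ (1 : Matrix V V ℝ), quadForm_smul]
    have h3 : quadForm (1 : Matrix V V ℝ) (b i) = 1 := by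
      rw [quadForm, ← h2]; congr 1; ext; simp
    rw [h3]
    simp [quadForm, PiLp.inner_apply, Matrix.toLpLin_apply, Matrix.mulVec, dotProduct,
      ← Finset.mul_sum]
    ring
  have h2 := b.sum_sq_norm_inner_right (WithLp.toLp 2 fun _ => (1 : ℝ))
  simp only [Real.norm_eq_abs, sq_abs] at h2
  simp_rw [quadForm_smul, abs_mul, ← Finset.mul_sum, h1]
  gcongr
  calc ∑ i, |inner ℝ (b i) (WithLp.toLp 2 fun _ => (1 : ℝ)) ^ 2 - (1 : ℝ)|
      ≤ ∑ i, (inner ℝ (b i) (WithLp.toLp 2 fun _ => (1 : ℝ)) ^ 2 + (1 : ℝ)) := by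
        refine Finset.sum_le_sum fun i _ => ?_
        rw [abs_le]
        constructor <;> nlinarith [sq_nonneg (inner ℝ (b i) (WithLp.toLp 2 fun _ => (1 : ℝ)) : ℝ)]
    _ = 2 * Fintype.card V := by
        rw [Finset.sum_add_distrib, h2, EuclideanSpace.norm_sq_eq]
        simp; ring

end Energy

/-! ### Resolvents on the imaginary axis -/

section Resolvent

variable {V : Type*} [Fintype V] [DecidableEq V]

/-- The resolvent `(X - i t)⁻¹` of a real matrix at a point of the imaginary axis. -/
def imagResolvent (X : Matrix V V ℝ) (t : ℝ) : Matrix V V ℂ :=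
  (X.map Complex.ofReal - (t * Complex.I : ℂ) • 1)⁻¹

variable {X : Matrix V V ℝ} (hX : X.IsHermitian) {t : ℝ} (ht : 0 < t)

theorem ofReal_sub_mul_I_ne_zero (x : ℝ) (ht : t ≠ 0) : (x : ℂ) - t * Complex.I ≠ 0 := by
  intro h
  have := congrArg Complex.im h
  simp [ht] at this

-- Diagonalising `X` by a real orthogonal matrix exhibits the inverse explicitly, which gives both
-- invertibility and the trace formula.
include hX ht in
theorem exists_imagResolvent_eq_conj : ∃ U U' : Matrix V V ℂ, U' * U = 1 ∧
    (X.map Complex.ofReal - (t * Complex.I : ℂ) • 1) *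
      (U * Matrix.diagonal (fun k => ((hX.eigenvalues k : ℂ) - t * Complex.I)⁻¹) * U') = 1 := by
  set U : Matrix V V ℝ := (hX.eigenvectorUnitary : Matrix V V ℝ) with hU
  refine ⟨U.map Complex.ofRealHom, (star U).map Complex.ofRealHom, ?_, ?_⟩
  · rw [← Matrix.map_mul, hU, Unitary.coe_star_mul_self]; simp
  · have h1 : U.map Complex.ofRealHom * (star U).map Complex.ofRealHom = 1 := by
      rw [← Matrix.map_mul, hU, Unitary.mul_star_self_of_mem hX.eigenvectorUnitary.2]; simp
    have h2 : (star U).map Complex.ofRealHom * U.map Complex.ofRealHom = 1 := by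
      rw [← Matrix.map_mul, hU, Unitary.coe_star_mul_self]; simp
    have h3 : X = U * Matrix.diagonal hX.eigenvalues * star U := by
      conv_lhs => rw [hX.spectral_theorem]
      rw [Unitary.conjStarAlgAut_apply]; rfl
    have h4 : X.map Complex.ofReal - (t * Complex.I : ℂ) • 1 =
        U.map Complex.ofRealHom * Matrix.diagonal (fun k => (hX.eigenvalues k : ℂ) - t * Complex.I) *
          (star U).map Complex.ofRealHom := by
      have h5 : Matrix.diagonal (fun k => (hX.eigenvalues k : ℂ) - t * Complex.I) =
          (Matrix.diagonal hX.eigenvalues).map Complex.ofRealHom - (t * Complex.I : ℂ) • 1 := by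
        rw [Matrix.diagonal_map (by simp), Matrix.smul_one_eq_diagonal, Matrix.diagonal_sub]
        rfl
      have h6 : X.map Complex.ofReal = X.map Complex.ofRealHom := rfl
      rw [h6, h5, mul_sub, sub_mul, ← Matrix.map_mul, ← Matrix.map_mul, ← h3]
      simp [h1]
    rw [h4]
    set D := Matrix.diagonal (fun k => (hX.eigenvalues k : ℂ) - t * Complex.I)
    set D' := Matrix.diagonal (fun k => ((hX.eigenvalues k : ℂ) - t * Complex.I)⁻¹)
    have h7 : D * D' = 1 := by
      rw [Matrix.diagonal_mul_diagonal, ← Matrix.diagonal_one]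
      congr 1; ext k
      exact mul_inv_cancel₀ (ofReal_sub_mul_I_ne_zero _ ht.ne')
    set A := U.map Complex.ofRealHom
    set A' := (star U).map Complex.ofRealHom
    calc A * D * A' * (A * D' * A') = A * D * (A' * A) * D' * A' := by noncomm_ring
      _ = 1 := by rw [h2, mul_one, mul_assoc A, h7, mul_one, h1]

include hX ht in
theorem mul_imagResolvent :
    (X.map Complex.ofReal - (t * Complex.I : ℂ) • 1) * imagResolvent X t = 1 := by
  obtain ⟨U, U', -, h⟩ := exists_imagResolvent_eq_conj hX ht
  rw [imagResolvent, Matrix.inv_eq_right_inv h, h]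

include ht in
theorem trace_imagResolvent :
    (imagResolvent X t).trace = ∑ k, ((hX.eigenvalues k : ℂ) - t * Complex.I)⁻¹ := by
  obtain ⟨U, U', h1, h⟩ := exists_imagResolvent_eq_conj hX ht
  rw [imagResolvent, Matrix.inv_eq_right_inv h, Matrix.trace_mul_cycle, h1, one_mul,
    Matrix.trace_diagonal]

include ht in
theorem im_trace_imagResolvent :
    (imagResolvent X t).trace.im = ∑ k, t / (hX.eigenvalues k ^ 2 + t ^ 2) := by
  rw [trace_imagResolvent hX ht, Complex.im_sum]
  refine Finset.sum_congr rfl fun k _ => ?_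
  simp [Complex.inv_im, Complex.normSq_apply, pow_two]

include hX in
theorem imagResolvent_comm (i j : V) : imagResolvent X t i j = imagResolvent X t j i := by
  have : (imagResolvent X t).transpose = imagResolvent X t := by
    rw [imagResolvent, Matrix.transpose_nonsing_inv]
    congr 1
    rw [Matrix.transpose_sub, Matrix.transpose_smul, Matrix.transpose_one, ← Matrix.transpose_map]
    congr 2
  conv_lhs => rw [← this]
  rfl

-- From (Y - it)R = 1 one gets R*(Y² + t²)R = 1; its (b, b) entry is ‖YR e_b‖² + t²‖R e_b‖² = 1. The
-- ℓ² bound on a whole column is what later saves a factor n over entrywise bounds.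
include hX ht in
theorem sum_norm_sq_imagResolvent_col_le (b : V) :
    ∑ a, ‖imagResolvent X t a b‖ ^ 2 ≤ 1 / t ^ 2 := by
  set R := imagResolvent X t with hR
  set Y : Matrix V V ℂ := X.map Complex.ofReal with hY
  have h0 : (Y - (t * Complex.I : ℂ) • 1) * R = 1 := mul_imagResolvent hX ht
  have hYY : Y.conjTranspose = Y := by
    ext i j
    have := hX.apply i j
    simp only [star_trivial] at this
    simp [hY, this]
  have h1 : (Y * R).conjTranspose * (Y * R) + ((t : ℂ) ^ 2) • (R.conjTranspose * R) = 1 := by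
    have h2 : ((Y - (t * Complex.I : ℂ) • 1) * R).conjTranspose *
        ((Y - (t * Complex.I : ℂ) • 1) * R) = 1 := by rw [h0]; simp
    rw [← h2]
    have h3 : (Y - (t * Complex.I : ℂ) • (1 : Matrix V V ℂ)).conjTranspose =
        Y + (t * Complex.I : ℂ) • 1 := by
      rw [Matrix.conjTranspose_sub, hYY, Matrix.conjTranspose_smul]
      simp [sub_eq_add_neg]
    rw [Matrix.conjTranspose_mul, Matrix.conjTranspose_mul, h3, hYY]
    have h4 : (Y + (t * Complex.I : ℂ) • 1) * (Y - (t * Complex.I : ℂ) • 1) =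
        Y * Y + ((t : ℂ) ^ 2) • 1 := by
      rw [add_mul, mul_sub, mul_sub]
      simp only [Matrix.smul_mul, Matrix.mul_smul, one_mul, mul_one, smul_smul]
      have : (t * Complex.I * (t * Complex.I) : ℂ) = -(t : ℂ) ^ 2 := by
        linear_combination (t : ℂ) ^ 2 * Complex.I_mul_I
      rw [this, neg_smul]
      abel
    calc _ = R.conjTranspose * (Y * Y + ((t : ℂ) ^ 2) • 1) * R := by
          rw [mul_add, add_mul]
          simp only [Matrix.smul_mul, Matrix.mul_smul, mul_one, mul_assoc]
      _ = _ := by rw [← h4]; simp only [mul_assoc]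
  have h5 := congrArg Complex.re (congrFun (congrFun h1 b) b)
  simp only [Matrix.add_apply, Matrix.smul_apply, Matrix.mul_apply (M := Matrix.conjTranspose _),
    Matrix.conjTranspose_apply, RCLike.star_def, Complex.conj_mul', Matrix.one_apply_eq,
    smul_eq_mul] at h5
  norm_cast at h5
  rw [le_div_iff₀ (by positivity)]
  have h6 : 0 ≤ ∑ a, ‖(Y * R) a b‖ ^ 2 := Finset.sum_nonneg fun _ _ => by positivity
  linarith

include hX ht in
theorem norm_imagResolvent_le (a b : V) : ‖imagResolvent X t a b‖ ≤ 1 / t := by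
  have h1 := sum_norm_sq_imagResolvent_col_le hX ht b
  have h2 := Finset.single_le_sum (f := fun a => ‖imagResolvent X t a b‖ ^ 2)
    (fun _ _ => by positivity) (Finset.mem_univ a)
  refine le_of_sq_le_sq ?_ (by positivity)
  rw [div_pow, one_pow]
  exact h2.trans h1

variable {Y : Matrix V V ℝ} (hY : Y.IsHermitian)

-- This is the resolvent identity P - Q = -w P S Q for the symmetric perturbation `S` supported on
-- one edge.
include hX hY ht in
theorem imagResolvent_sub_apply {w : ℝ} {i j : V}
    (h : X = Y + w • (Matrix.single i j 1 + Matrix.single j i 1)) (a b : V) :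
    imagResolvent X t a b - imagResolvent Y t a b =
      -w * (imagResolvent X t a i * imagResolvent Y t j b +
        imagResolvent X t a j * imagResolvent Y t i b) := by
  have h1 : imagResolvent X t * (X.map Complex.ofReal - (t * Complex.I : ℂ) • 1) = 1 :=
    mul_eq_one_comm.1 (mul_imagResolvent hX ht)
  have h2 := mul_imagResolvent hY ht
  have h3 : X.map Complex.ofReal - (t * Complex.I : ℂ) • 1 =
      (Y.map Complex.ofReal - (t * Complex.I : ℂ) • 1) +
        ((w : ℂ) • (Matrix.single i j 1 + Matrix.single j i 1) : Matrix V V ℂ) := by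
    ext k l
    simp [h, Matrix.single_apply, apply_ite Complex.ofReal]
    ring
  set P := imagResolvent X t
  set Q := imagResolvent Y t
  rw [h3] at h1
  set A := Y.map Complex.ofReal - (t * Complex.I : ℂ) • 1
  set S : Matrix V V ℂ := Matrix.single i j 1 + Matrix.single j i 1 with hS
  have h4 : P - Q = (-(w : ℂ)) • (P * S * Q) := by
    calc P - Q = P * (A * Q) - (P * (A + (w : ℂ) • S)) * Q := by rw [h1, h2]; simp
      _ = _ := by
        simp only [mul_add, add_mul, mul_assoc, Matrix.smul_mul, Matrix.mul_smul, neg_smul]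
        abel
  have h5 := congrFun (congrFun h4 a) b
  rw [Matrix.sub_apply] at h5
  rw [h5, Matrix.smul_apply, smul_eq_mul, hS, mul_add, add_mul, Matrix.add_apply]
  congr 2 <;>
  · rw [Matrix.mul_apply, Finset.sum_eq_single_of_mem _ (Finset.mem_univ _)]
    · rw [Matrix.mul_single_apply_same, mul_one]
    · intro k _ hk
      rw [Matrix.mul_single_apply_of_ne _ _ _ _ _ hk, zero_mul]

include hX hY ht in
theorem norm_imagResolvent_sub_le {w : ℝ} {i j : V}
    (h : X = Y + w • (Matrix.single i j 1 + Matrix.single j i 1)) (a b : V) :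
    ‖imagResolvent X t a b - imagResolvent Y t a b‖ ≤ 2 * |w| / t ^ 2 := by
  rw [imagResolvent_sub_apply hX ht hY h, norm_mul, norm_neg, Complex.norm_real, Real.norm_eq_abs]
  calc _ ≤ |w| * (1 / t * (1 / t) + 1 / t * (1 / t)) := by
        gcongr
        refine (norm_add_le _ _).trans ?_
        rw [norm_mul, norm_mul]
        gcongr <;> first | exact norm_imagResolvent_le hX ht _ _ |
          exact norm_imagResolvent_le hY ht _ _
    _ = _ := by field_simp; ring

-- The column bounds make each sum over `a` at most 1/t², so the bound carries no factor n, unlike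
-- summation of the entrywise estimate.
include hX hY ht in
theorem norm_trace_imagResolvent_sub_le {w : ℝ} {i j : V}
    (h : X = Y + w • (Matrix.single i j 1 + Matrix.single j i 1)) :
    ‖(imagResolvent X t).trace - (imagResolvent Y t).trace‖ ≤ 2 * |w| / t ^ 2 := by
  have key : ∀ k l, ‖∑ a, imagResolvent X t a k * imagResolvent Y t l a‖ ≤ 1 / t ^ 2 := by
    intro k l
    have h1 := sum_norm_sq_imagResolvent_col_le hX ht k
    have h2 := sum_norm_sq_imagResolvent_col_le hY ht l
    calc _ ≤ ∑ a, (‖imagResolvent X t a k‖ ^ 2 + ‖imagResolvent Y t a l‖ ^ 2) / 2 := by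
          refine (norm_sum_le _ _).trans (Finset.sum_le_sum fun a _ => ?_)
          rw [norm_mul, imagResolvent_comm hY l a]
          nlinarith [sq_nonneg (‖imagResolvent X t a k‖ - ‖imagResolvent Y t a l‖)]
      _ ≤ _ := by
          rw [← Finset.sum_div, Finset.sum_add_distrib]; linarith
  rw [Matrix.trace, Matrix.trace, ← Finset.sum_sub_distrib]
  simp only [Matrix.diag_apply, imagResolvent_sub_apply hX ht hY h]
  rw [← Finset.mul_sum, Finset.sum_add_distrib, norm_mul, norm_neg, Complex.norm_real,
    Real.norm_eq_abs]
  calc _ ≤ |w| * (1 / t ^ 2 + 1 / t ^ 2) := by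
        gcongr
        exact (norm_add_le _ _).trans (add_le_add (key _ _) (key _ _))
    _ = _ := by ring

end Resolvent

/-! ### The centred adjacency matrix and the effect of one edge -/

section LoopEquation

variable {V : Type*} [Fintype V] [DecidableEq V]

open Classical in
/-- The centred and normalised adjacency matrix. -/
def centredAdj (p : ℝ) (G : SimpleGraph V) : Matrix V V ℝ :=
  Matrix.of fun i j =>
    if i = j then 0 else ((if G.Adj i j then 1 else 0) - p) / √(Fintype.card V)

theorem centredAdj_isHermitian (p : ℝ) (G : SimpleGraph V) : (centredAdj p G).IsHermitian := by
  ext i j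
  by_cases h : G.Adj i j
  · simp [centredAdj, h, h.symm, eq_comm (a := j)]
  · have h' : ¬ G.Adj j i := fun h' => h h'.symm
    simp [centredAdj, h, h', eq_comm (a := j)]

theorem centredAdj_sup_edge (p : ℝ) (G : SimpleGraph V) {i j : V} (hij : i ≠ j) :
    centredAdj p (G ⊔ edge i j) = centredAdj p (G \ edge i j) +
      (1 / √(Fintype.card V)) • (Matrix.single i j 1 + Matrix.single j i 1) := by
  classical
  ext a b
  by_cases hab : a = b
  · subst hab
    have h1 : ¬ (i = a ∧ j = a) := fun h => hij (h.1.trans h.2.symm)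
    have h2 : ¬ (j = a ∧ i = a) := fun h => hij (h.2.trans h.1.symm)
    simp [centredAdj, h1, h2]
  · by_cases h1 : a = i ∧ b = j
    · obtain ⟨rfl, rfl⟩ := h1
      simp [centredAdj, hij, hij.symm, edge_adj]
      ring
    · by_cases h2 : a = j ∧ b = i
      · obtain ⟨rfl, rfl⟩ := h2
        simp [centredAdj, hij, hij.symm, edge_adj]
        ring
      · have h3 : ¬ (i = a ∧ j = b) := fun h => h1 ⟨h.1.symm, h.2.symm⟩
        have h4 : ¬ (j = a ∧ i = b) := fun h => h2 ⟨h.1.symm, h.2.symm⟩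
        simp [centredAdj, hab, edge_adj, h1, h2, h3, h4]

omit [Fintype V] [DecidableEq V] in
theorem eq_sup_edge_or_eq_sdiff_edge (G : SimpleGraph V) (i j : V) :
    G = G ⊔ edge i j ∨ G = G \ edge i j := by
  by_cases h : G.Adj i j
  · exact Or.inl (sup_edge_of_adj G h).symm
  · exact Or.inr (sdiff_edge G h).symm

theorem norm_mul_sub_mul_le {a b c d : ℂ} {A D : ℝ} (ha : ‖a‖ ≤ A) (hd : ‖d‖ ≤ D) :
    ‖a * b - c * d‖ ≤ A * ‖b - d‖ + ‖a - c‖ * D := by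
  calc ‖a * b - c * d‖ = ‖a * (b - d) + (a - c) * d‖ := by ring_nf
    _ ≤ ‖a‖ * ‖b - d‖ + ‖a - c‖ * ‖d‖ := by
      rw [← norm_mul, ← norm_mul]; exact norm_add_le _ _
    _ ≤ _ := by gcongr

/-- Integration by parts for an entry of the centred adjacency matrix. -/
theorem mean_centredAdj_mul (p : ℝ) {i j : V} (hij : i ≠ j) (f : SimpleGraph V → ℂ) :
    mean p (fun G => (centredAdj p G i j : ℂ) * f G) =
      (p * (1 - p) / √(Fintype.card V) : ℝ) •
        mean p (fun G => f (G ⊔ edge i j) - f (G \ edge i j)) := by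
  classical
  -- The entry is (1 - p)/√n with the edge and -p/√n without it; weighted by p and 1 - p these
  -- become ±p(1 - p)/√n.
  rw [mean_resample p hij, ← mean_smul]
  congr 1; ext G
  simp [centredAdj, hij, edge_adj]
  ring

variable (p : ℝ) (t : ℝ) (G : SimpleGraph V)

/-- The resolvent of the centred adjacency matrix. -/
def graphResolvent : Matrix V V ℂ := imagResolvent (centredAdj p G) t

/-- The Stieltjes transform of the spectral distribution of the centred adjacency matrix. -/
def stieltjes : ℂ := (graphResolvent p t G).trace / Fintype.card V

/-- The defect in the self-consistent equation for the Stieltjes transform. -/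
def loopDefect : ℂ :=
  t * Complex.I * stieltjes p t G + 1 + (p * (1 - p) : ℝ) * stieltjes p t G ^ 2

variable {p t G} (ht : 0 < t)

include ht

theorem norm_graphResolvent_le (a b : V) : ‖graphResolvent p t G a b‖ ≤ 1 / t :=
  norm_imagResolvent_le (centredAdj_isHermitian p G) ht a b

theorem norm_stieltjes_le : ‖stieltjes p t G‖ ≤ 1 / t := by
  rw [stieltjes, norm_div, Complex.norm_natCast]
  refine div_le_of_le_mul₀ (by positivity) (by positivity) ?_
  refine (norm_sum_le _ _).trans ?_
  refine (Finset.sum_le_card_nsmul _ _ (1 / t) fun a _ => norm_graphResolvent_le ht a a).trans ?_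
  simp [mul_comm]

theorem norm_loopDefect_le (h0 : 0 ≤ p * (1 - p)) (h1 : p * (1 - p) ≤ 1) :
    ‖loopDefect p t G‖ ≤ 2 + 1 / t ^ 2 := by
  have hs := norm_stieltjes_le (p := p) (G := G) ht
  calc ‖loopDefect p t G‖ ≤ t * ‖stieltjes p t G‖ + 1 + 1 * ‖stieltjes p t G‖ ^ 2 := by
        refine (norm_add₃_le).trans ?_
        simp only [norm_mul, Complex.norm_real, Complex.norm_I, mul_one, norm_one, norm_pow,
          Real.norm_of_nonneg ht.le, Real.norm_of_nonneg h0]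
        gcongr
    _ ≤ t * (1 / t) + 1 + 1 * (1 / t) ^ 2 := by gcongr
    _ = _ := by field_simp; ring

theorem norm_graphResolvent_sup_sub_le {i j : V} (hij : i ≠ j) (a b : V) :
    ‖graphResolvent p t (G ⊔ edge i j) a b - graphResolvent p t (G \ edge i j) a b‖ ≤
      2 / t ^ 2 * (1 / √(Fintype.card V)) := by
  refine (norm_imagResolvent_sub_le (centredAdj_isHermitian _ _) ht (centredAdj_isHermitian _ _)
    (centredAdj_sup_edge p G hij) a b).trans (le_of_eq ?_)
  rw [abs_of_nonneg (by positivity)]; ring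

theorem norm_stieltjes_sup_sub_le {i j : V} (hij : i ≠ j) :
    ‖stieltjes p t (G ⊔ edge i j) - stieltjes p t (G \ edge i j)‖ ≤
      2 / t ^ 2 * (1 / √(Fintype.card V)) / Fintype.card V := by
  rw [stieltjes, stieltjes, ← sub_div, norm_div, Complex.norm_natCast]
  gcongr
  refine (norm_trace_imagResolvent_sub_le (centredAdj_isHermitian _ _) ht
    (centredAdj_isHermitian _ _) (centredAdj_sup_edge p G hij)).trans (le_of_eq ?_)
  rw [abs_of_nonneg (by positivity)]; ring

theorem norm_loopDefect_sup_sub_le (h0 : 0 ≤ p * (1 - p)) (h1 : p * (1 - p) ≤ 1) {i j : V}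
    (hij : i ≠ j) :
    ‖loopDefect p t (G ⊔ edge i j) - loopDefect p t (G \ edge i j)‖ ≤
      (t + 2 / t) * (2 / t ^ 2 * (1 / √(Fintype.card V)) / Fintype.card V) := by
  have hs := norm_stieltjes_sup_sub_le (p := p) (G := G) ht hij
  have hp := norm_stieltjes_le (p := p) (G := G ⊔ edge i j) ht
  have hm := norm_stieltjes_le (p := p) (G := G \ edge i j) ht
  set x := stieltjes p t (G ⊔ edge i j)
  set y := stieltjes p t (G \ edge i j)
  have h : loopDefect p t (G ⊔ edge i j) - loopDefect p t (G \ edge i j) =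
      (x - y) * (t * Complex.I + (p * (1 - p) : ℝ) * (x + y)) := by
    simp only [loopDefect]; ring
  have h2 : ‖(t * Complex.I + (p * (1 - p) : ℝ) * (x + y) : ℂ)‖ ≤ t + 2 / t := by
    refine (norm_add_le _ _).trans ?_
    rw [norm_mul, norm_mul, Complex.norm_real, Complex.norm_I, mul_one, Complex.norm_real,
      Real.norm_of_nonneg ht.le, Real.norm_of_nonneg h0]
    gcongr
    calc _ ≤ 1 * (1 / t + 1 / t) := by
          gcongr; exact (norm_add_le _ _).trans (add_le_add hp hm)
      _ = _ := by ring
  rw [h, norm_mul, mul_comm]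
  gcongr

/-- The constant in the edge-wise estimate of the loop equation. -/
def edgeConst (t : ℝ) : ℝ :=
  2 / t ^ 2 * (4 / t * (2 + 1 / t ^ 2) + 2 / t ^ 2 * (t + 2 / t) + 1 / t * (t + 2 / t))

/-- To leading order the discrete derivative of R_ji is -(R_ji² + R_jj R_ii)/√n. Replacing the mixed
products by those at `G` costs another factor 1/√n, and the defect itself moves only by O(n^(-3/2)),
so the total error is O(1/n). -/
theorem norm_edge_difference_le (h0 : 0 ≤ p * (1 - p)) (h1 : p * (1 - p) ≤ 1) {i j : V}
    (hij : i ≠ j) :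
    ‖graphResolvent p t (G ⊔ edge i j) j i * star (loopDefect p t (G ⊔ edge i j)) -
      graphResolvent p t (G \ edge i j) j i * star (loopDefect p t (G \ edge i j)) +
      (1 / √(Fintype.card V) : ℝ) *
        ((graphResolvent p t G j i ^ 2 + graphResolvent p t G j j * graphResolvent p t G i i) *
          star (loopDefect p t G))‖ ≤ edgeConst t / Fintype.card V := by
  set n : ℝ := (Fintype.card V : ℝ) with hn
  have hn1 : 1 ≤ n := by
    have : 0 < Fintype.card V := Fintype.card_pos_iff.2 ⟨i⟩
    rw [hn]; exact_mod_cast this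
  set w : ℝ := 1 / √n with hw
  have hw0 : 0 ≤ w := by positivity
  have hw1 : w ≤ 1 := by
    rw [hw, div_le_one (by positivity)]; exact Real.one_le_sqrt.2 hn1
  have hww : w * w = 1 / n := by
    rw [hw, div_mul_div_comm, Real.mul_self_sqrt (by positivity), one_mul]
  set Rp := graphResolvent p t (G ⊔ edge i j) with hRp
  set Rm := graphResolvent p t (G \ edge i j) with hRm
  set R := graphResolvent p t G with hR
  set Hp := star (loopDefect p t (G ⊔ edge i j)) with hHp
  set Hm := star (loopDefect p t (G \ edge i j)) with hHm
  set H := star (loopDefect p t G) with hH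
  set δ := 2 / t ^ 2 * w with hδ
  have hδ0 : 0 ≤ δ := by positivity
  set B := 2 + 1 / t ^ 2 with hB
  set L := t + 2 / t with hL
  have bRp : ∀ a b, ‖Rp a b‖ ≤ 1 / t := norm_graphResolvent_le ht
  have bRm : ∀ a b, ‖Rm a b‖ ≤ 1 / t := norm_graphResolvent_le ht
  have bR : ∀ a b, ‖R a b‖ ≤ 1 / t := norm_graphResolvent_le ht
  have dR : ∀ a b, ‖Rp a b - Rm a b‖ ≤ δ := norm_graphResolvent_sup_sub_le ht hij
  have bHp : ‖Hp‖ ≤ B := by rw [hHp, norm_star]; exact norm_loopDefect_le ht h0 h1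
  have dH : ‖Hp - Hm‖ ≤ L * (δ / n) := by
    rw [hHp, hHm, ← star_sub, norm_star]; exact norm_loopDefect_sup_sub_le ht h0 h1 hij
  -- `G` is itself one of the two resampled graphs, so bounds on their difference also control the
  -- distance to `G`.
  have hcase : (R = Rp ∧ H = Hp) ∨ (R = Rm ∧ H = Hm) := by
    rcases eq_sup_edge_or_eq_sdiff_edge G i j with h | h
    · left; exact ⟨by rw [hR, hRp, ← h], by rw [hH, hHp, ← h]⟩
    · right; exact ⟨by rw [hR, hRm, ← h], by rw [hH, hHm, ← h]⟩
  have dRp : ∀ a b, ‖Rp a b - R a b‖ ≤ δ := by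
    intro a b
    rcases hcase with h | h <;> rw [h.1]
    · simpa using hδ0
    · exact dR a b
  have dRm : ∀ a b, ‖Rm a b - R a b‖ ≤ δ := by
    intro a b
    rcases hcase with h | h <;> rw [h.1]
    · rw [norm_sub_rev]; exact dR a b
    · simpa using hδ0
  have dHp : ‖Hp - H‖ ≤ L * (δ / n) := by
    rcases hcase with h | h <;> rw [h.2]
    · simp; positivity
    · exact dH
  have hres : Rp j i - Rm j i = -(w : ℂ) * (Rp j i * Rm j i + Rp j j * Rm i i) :=
    imagResolvent_sub_apply (centredAdj_isHermitian _ _) ht (centredAdj_isHermitian _ _)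
      (centredAdj_sup_edge p G hij) j i
  have hprod : ∀ a b c d, ‖Rp a b * Rm c d - R a b * R c d‖ ≤ 2 / t * δ := by
    intro a b c d
    calc _ ≤ 1 / t * ‖Rm c d - R c d‖ + ‖Rp a b - R a b‖ * (1 / t) :=
          norm_mul_sub_mul_le (bRp a b) (bR c d)
      _ ≤ 1 / t * δ + δ * (1 / t) := by gcongr; exacts [dRm c d, dRp a b]
      _ = _ := by ring
  have hQ : ‖(Rp j i * Rm j i + Rp j j * Rm i i) * Hp - (R j i ^ 2 + R j j * R i i) * H‖ ≤
      4 / t * δ * B + 2 / t ^ 2 * (L * (δ / n)) := by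
    have e : (Rp j i * Rm j i + Rp j j * Rm i i) * Hp - (R j i ^ 2 + R j j * R i i) * H =
        ((Rp j i * Rm j i - R j i * R j i) + (Rp j j * Rm i i - R j j * R i i)) * Hp +
          (R j i * R j i + R j j * R i i) * (Hp - H) := by ring
    rw [e]
    refine (norm_add_le _ _).trans (add_le_add ?_ ?_)
    · rw [norm_mul]
      calc _ ≤ (2 / t * δ + 2 / t * δ) * B := by
            gcongr
            exact (norm_add_le _ _).trans (add_le_add (hprod _ _ _ _) (hprod _ _ _ _))
        _ = _ := by ring
    · rw [norm_mul]
      calc _ ≤ (1 / t * (1 / t) + 1 / t * (1 / t)) * (L * (δ / n)) := by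
            gcongr
            refine (norm_add_le _ _).trans ?_
            rw [norm_mul, norm_mul]
            gcongr <;> apply bR
        _ = _ := by ring
  have e : Rp j i * Hp - Rm j i * Hm + (w : ℂ) * ((R j i ^ 2 + R j j * R i i) * H) =
      -(w : ℂ) * ((Rp j i * Rm j i + Rp j j * Rm i i) * Hp - (R j i ^ 2 + R j j * R i i) * H) +
        Rm j i * (Hp - Hm) := by
    linear_combination Hp * hres
  rw [e]
  calc _ ≤ w * (4 / t * δ * B + 2 / t ^ 2 * (L * (δ / n))) + 1 / t * (L * (δ / n)) := by
        refine (norm_add_le _ _).trans ?_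
        rw [norm_mul, norm_neg, Complex.norm_real, Real.norm_of_nonneg hw0, norm_mul]
        gcongr
        exact bRm j i
    _ = 2 / t ^ 2 * (4 / t * B * (w * w) + 2 / t ^ 2 * L * (w * w) / n + 1 / t * L * w / n) := by
        rw [hδ]; ring
    _ ≤ 2 / t ^ 2 * (4 / t * B * (1 / n) + 2 / t ^ 2 * L * 1 / n + 1 / t * L * 1 / n) := by
        have : w * w ≤ 1 := mul_le_one₀ hw1 hw0 hw1
        gcongr
        exact hww.le
    _ = edgeConst t / n := by rw [edgeConst]; ring

end LoopEquation

/-! ### Second moment of the defect and stability of the quadratic equation -/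

section SelfConsistent

variable {V : Type*} [Fintype V] [DecidableEq V]
variable {p : unitInterval} {t : ℝ} (ht : 0 < t)

theorem unitInterval_mul_one_sub_nonneg (p : unitInterval) : 0 ≤ (p : ℝ) * (1 - p) :=
  mul_nonneg p.2.1 (sub_nonneg.2 p.2.2)

theorem unitInterval_mul_one_sub_le_one (p : unitInterval) : (p : ℝ) * (1 - p) ≤ 1 := by
  nlinarith [p.2.1, p.2.2]

include ht

/-- The trace of (X - it)R = 1 gives Σ X_ij R_ji = n + it tr R, and Σ R_jj R_ii = (tr R)². -/
theorem loopDefect_eq (p : ℝ) [Nonempty V] (G : SimpleGraph V) :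
    loopDefect p t G = (∑ i, ∑ j, ((centredAdj p G i j : ℂ) * graphResolvent p t G j i +
      (p * (1 - p) / Fintype.card V : ℝ) *
        (graphResolvent p t G j j * graphResolvent p t G i i))) / Fintype.card V := by
  have hn : (Fintype.card V : ℂ) ≠ 0 := by exact_mod_cast Fintype.card_ne_zero
  have h := congrArg Matrix.trace (mul_imagResolvent (centredAdj_isHermitian p G) ht)
  rw [sub_mul, Matrix.smul_mul, one_mul, Matrix.trace_sub, Matrix.trace_smul, Matrix.trace_one,
    smul_eq_mul, Matrix.trace] at h
  simp only [Matrix.diag_apply, Matrix.mul_apply, Matrix.map_apply] at h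
  have h2 : ∑ i : V, ∑ j : V, (graphResolvent p t G j j * graphResolvent p t G i i) =
      (graphResolvent p t G).trace ^ 2 := by
    rw [sq, Matrix.trace, Finset.sum_mul_sum, Finset.sum_comm]; rfl
  simp only [Finset.sum_add_distrib, ← Finset.mul_sum, h2]
  have h3 : ∑ i, ∑ j, (centredAdj p G i j : ℂ) * graphResolvent p t G j i =
      Fintype.card V + t * Complex.I * (graphResolvent p t G).trace := by
    rw [← h, graphResolvent]; ring
  rw [h3, loopDefect, stieltjes]
  push_cast
  field_simp
  ring

/-- The edge-wise form of the loop equation. -/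
theorem norm_mean_loop_entry_le [Nonempty V] (i j : V) :
    ‖mean (p : ℝ) (fun G : SimpleGraph V =>
        (centredAdj (p : ℝ) G i j : ℂ) * graphResolvent (p : ℝ) t G j i *
          star (loopDefect (p : ℝ) t G) +
        ((p : ℝ) * (1 - p) / Fintype.card V : ℝ) *
          ((graphResolvent (p : ℝ) t G j i ^ 2 +
            graphResolvent (p : ℝ) t G j j * graphResolvent (p : ℝ) t G i i) *
              star (loopDefect (p : ℝ) t G)))‖ ≤
      (edgeConst t * (1 / √(Fintype.card V)) +
        if i = j then 2 / t ^ 2 * (2 + 1 / t ^ 2) else 0) / Fintype.card V := by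
  have h0 := unitInterval_mul_one_sub_nonneg p
  have h1 := unitInterval_mul_one_sub_le_one p
  set v : ℝ := (p : ℝ) * (1 - p) with hv
  have hn : (1 : ℝ) ≤ Fintype.card V := by exact_mod_cast Fintype.card_pos
  have hec : 0 ≤ edgeConst t := by rw [edgeConst]; positivity
  -- On the diagonal the entry of `X` vanishes and there is no edge to resample; a crude bound
  -- suffices, as there are only n such terms.
  by_cases hij : i = j
  · subst hij
    rw [if_pos rfl]
    have hW : ∀ G : SimpleGraph V, centredAdj (p : ℝ) G i i = 0 := fun G => by simp [centredAdj]
    have hb : ∀ G : SimpleGraph V, ‖((centredAdj (p : ℝ) G i i : ℂ) *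
          graphResolvent (p : ℝ) t G i i * star (loopDefect (p : ℝ) t G) +
        (v / Fintype.card V : ℝ) *
          ((graphResolvent (p : ℝ) t G i i ^ 2 +
            graphResolvent (p : ℝ) t G i i * graphResolvent (p : ℝ) t G i i) *
              star (loopDefect (p : ℝ) t G)))‖ ≤
        1 / Fintype.card V * ((2 / t ^ 2) * (2 + 1 / t ^ 2)) := by
      intro G
      have hR := norm_graphResolvent_le (p := (p : ℝ)) (G := G) ht i i
      have hF := norm_loopDefect_le (p := (p : ℝ)) (G := G) ht h0 h1
      rw [hW, Complex.ofReal_zero, zero_mul, zero_mul, zero_add, norm_mul, norm_mul, norm_star,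
        Complex.norm_real, Real.norm_of_nonneg (by positivity)]
      gcongr
      calc _ ≤ (1 / t) ^ 2 + 1 / t * (1 / t) := by
            refine (norm_add_le _ _).trans ?_
            rw [norm_pow, norm_mul]; gcongr
        _ = _ := by ring
    refine (norm_mean_le p.2.1 p.2.2 _).trans ((mean_mono p.2.1 p.2.2 hb).trans ?_)
    rw [mean_const, add_div]
    have : 0 ≤ edgeConst t * (1 / √(Fintype.card V)) / Fintype.card V := by positivity
    calc _ = 2 / t ^ 2 * (2 + 1 / t ^ 2) / Fintype.card V := by ring
      _ ≤ _ := by linarith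
  · rw [if_neg hij, add_zero, mean_add]
    simp only [mul_assoc (centredAdj _ _ _ _ : ℂ)]
    rw [mean_centredAdj_mul _ hij, ← hv]
    have e : mean (p : ℝ) (fun G : SimpleGraph V => ((v / Fintype.card V : ℝ) : ℂ) *
          ((graphResolvent (p : ℝ) t G j i ^ 2 +
            graphResolvent (p : ℝ) t G j j * graphResolvent (p : ℝ) t G i i) *
              star (loopDefect (p : ℝ) t G))) =
        (v / √(Fintype.card V) : ℝ) • mean (p : ℝ) (fun G : SimpleGraph V =>
          (1 / √(Fintype.card V) : ℝ) * ((graphResolvent (p : ℝ) t G j i ^ 2 +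
            graphResolvent (p : ℝ) t G j j * graphResolvent (p : ℝ) t G i i) *
              star (loopDefect (p : ℝ) t G))) := by
      rw [← mean_smul]
      congr 1; ext G
      have hc : ((v / Fintype.card V : ℝ) : ℂ) =
          (v / √(Fintype.card V) : ℝ) * (1 / √(Fintype.card V) : ℝ) := by
        rw [← Complex.ofReal_mul, div_mul_div_comm, mul_one, Real.mul_self_sqrt (by positivity)]
      rw [Complex.real_smul, hc]
      ring
    rw [e, ← smul_add, ← mean_add, norm_smul, Real.norm_of_nonneg (by positivity)]
    calc _ ≤ v / √(Fintype.card V) * (edgeConst t / Fintype.card V) := by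
          gcongr
          refine (norm_mean_le p.2.1 p.2.2 _).trans ?_
          rw [← mean_const (V := V) p (edgeConst t / Fintype.card V)]
          exact mean_mono p.2.1 p.2.2 fun G => norm_edge_difference_le ht h0 h1 hij
      _ ≤ 1 / √(Fintype.card V) * (edgeConst t / Fintype.card V) := by gcongr
      _ = _ := by ring

/-- The constant in the second moment bound of the loop defect. -/
def loopConst (t : ℝ) : ℝ := edgeConst t + 3 / t ^ 2 * (2 + 1 / t ^ 2)

/-- In |F|² = F F̄ only the first factor is expanded by `loopDefect_eq`. Integration by parts
cancels its main terms up to a sum of R_ji² F̄, which the column bound makes O(1/n) after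
normalisation. -/
theorem mean_norm_loopDefect_sq_le [Nonempty V] :
    mean (p : ℝ) (fun G : SimpleGraph V => ‖loopDefect (p : ℝ) t G‖ ^ 2) ≤
      loopConst t / √(Fintype.card V) := by
  have h0 := unitInterval_mul_one_sub_nonneg p
  have h1 := unitInterval_mul_one_sub_le_one p
  have hn : (1 : ℝ) ≤ Fintype.card V := by exact_mod_cast Fintype.card_pos
  have hn0 : (Fintype.card V : ℝ) ≠ 0 := by positivity
  have hn0' : (Fintype.card V : ℂ) ≠ 0 := by exact_mod_cast hn0
  set F : SimpleGraph V → ℂ := fun G => loopDefect (p : ℝ) t G with hF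
  set R : SimpleGraph V → Matrix V V ℂ := fun G => graphResolvent (p : ℝ) t G with hR
  set v : ℝ := (p : ℝ) * (1 - p) with hv
  set Q : V → V → SimpleGraph V → ℂ := fun i j G =>
    (centredAdj (p : ℝ) G i j : ℂ) * R G j i * star (F G) +
      (v / Fintype.card V : ℝ) * ((R G j i ^ 2 + R G j j * R G i i) * star (F G)) with hQ
  set B : ℝ := 2 + 1 / t ^ 2 with hB
  have e1 : ∀ G, ((‖F G‖ ^ 2 : ℝ) : ℂ) = ((1 / Fintype.card V : ℝ) : ℂ) • (∑ i, ∑ j, Q i j G) +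
      ((-(v / Fintype.card V / Fintype.card V) : ℝ) : ℂ) • ((∑ i, ∑ j, R G j i ^ 2) * star (F G)) := by
    intro G
    have : ((‖F G‖ ^ 2 : ℝ) : ℂ) = F G * star (F G) := by
      rw [RCLike.star_def, Complex.mul_conj']; norm_cast
    have hL : F G = (∑ i, ∑ j, ((centredAdj (p : ℝ) G i j : ℂ) * R G j i +
      (v / Fintype.card V : ℝ) * (R G j j * R G i i))) / Fintype.card V := loopDefect_eq ht _ G
    rw [this]
    simp only [hQ]
    generalize star (F G) = z
    rw [hL]
    simp only [smul_eq_mul, Finset.sum_add_distrib, ← Finset.mul_sum, ← Finset.sum_mul]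
    push_cast
    field_simp
    ring
  have e2 : ((mean (p : ℝ) (fun G : SimpleGraph V => ‖F G‖ ^ 2) : ℝ) : ℂ) =
      mean (p : ℝ) (fun G => ((‖F G‖ ^ 2 : ℝ) : ℂ)) := by
    simp [mean]
  have b1 : ‖∑ i, ∑ j, mean (p : ℝ) (Q i j)‖ ≤
      Fintype.card V * (edgeConst t * (1 / √(Fintype.card V))) + 2 / t ^ 2 * B := by
    refine (norm_sum_le _ _).trans ((Finset.sum_le_sum fun i _ => (norm_sum_le _ _).trans
      (Finset.sum_le_sum fun j _ => norm_mean_loop_entry_le ht i j)).trans (le_of_eq ?_))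
    simp only [← Finset.sum_div, Finset.sum_add_distrib, Finset.sum_const, Finset.card_univ,
      nsmul_eq_mul, Finset.sum_ite_eq, Finset.mem_univ, if_true]
    rw [hB]
    field_simp
  have b2 : ‖mean (p : ℝ) (fun G => (∑ i, ∑ j, R G j i ^ 2) * star (F G))‖ ≤
      Fintype.card V * (1 / t ^ 2) * B := by
    refine (norm_mean_le p.2.1 p.2.2 _).trans ?_
    rw [← mean_const (V := V) p ((Fintype.card V : ℝ) * (1 / t ^ 2) * B)]
    refine mean_mono p.2.1 p.2.2 fun G => ?_
    rw [norm_mul, norm_star]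
    gcongr
    · refine (norm_sum_le _ _).trans ((Finset.sum_le_card_nsmul _ _ (1 / t ^ 2) fun i _ =>
        (norm_sum_le _ _).trans ?_).trans (le_of_eq (by simp)))
      simp only [norm_pow]
      exact sum_norm_sq_imagResolvent_col_le (centredAdj_isHermitian _ _) ht i
    · exact norm_loopDefect_le ht h0 h1
  have e3 : ((mean (p : ℝ) (fun G : SimpleGraph V => ‖F G‖ ^ 2) : ℝ) : ℂ) =
      ((1 / Fintype.card V : ℝ) : ℂ) • (∑ i, ∑ j, mean (p : ℝ) (Q i j)) +
      ((-(v / Fintype.card V / Fintype.card V) : ℝ) : ℂ) •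
        mean (p : ℝ) (fun G => (∑ i, ∑ j, R G j i ^ 2) * star (F G)) := by
    rw [e2]
    simp only [e1]
    rw [mean_add, mean_smul, mean_smul, mean_sum]
    simp only [mean_sum]
  have hsq : 1 / (Fintype.card V : ℝ) ≤ 1 / √(Fintype.card V) := by
    gcongr
    rw [Real.sqrt_le_left (by positivity)]
    nlinarith
  have hnorm := congrArg norm e3
  rw [Complex.norm_real, Real.norm_of_nonneg (mean_nonneg p.2.1 p.2.2 fun G => by positivity)]
    at hnorm
  rw [hnorm]
  calc _ ≤ 1 / Fintype.card V * (Fintype.card V * (edgeConst t * (1 / √(Fintype.card V))) +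
        2 / t ^ 2 * B) + (v / Fintype.card V / Fintype.card V) *
          (Fintype.card V * (1 / t ^ 2) * B) := by
        refine (norm_add_le _ _).trans ?_
        rw [norm_smul, norm_smul, Complex.norm_real, Complex.norm_real, norm_neg,
          Real.norm_of_nonneg (by positivity), Real.norm_of_nonneg (by positivity)]
        gcongr
    _ = edgeConst t * (1 / √(Fintype.card V)) + (2 + v) / t ^ 2 * B * (1 / Fintype.card V) := by
        field_simp
        ring
    _ ≤ edgeConst t * (1 / √(Fintype.card V)) + (2 + 1) / t ^ 2 * B * (1 / √(Fintype.card V)) := by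
        gcongr
    _ = loopConst t / √(Fintype.card V) := by rw [loopConst]; ring

omit ht in
theorem mean_le_sqrt (f : SimpleGraph V → ℝ) :
    mean (p : ℝ) f ≤ √(mean (p : ℝ) fun G => f G ^ 2) := by
  refine Real.le_sqrt_of_sq_le ?_
  set c := mean (p : ℝ) f with hc
  have h : 0 ≤ mean (p : ℝ) (fun G => (f G - c) ^ 2) :=
    mean_nonneg p.2.1 p.2.2 fun G => sq_nonneg _
  have e : ∀ G, (f G - c) ^ 2 = f G ^ 2 + ((-2 * c) • f G + c ^ 2) := fun G => by
    rw [smul_eq_mul]; ring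
  simp only [e] at h
  rw [mean_add, mean_add, mean_smul, mean_const, ← hc, smul_eq_mul] at h
  nlinarith

omit ht in
/-- The Stieltjes transform, divided by `i`, of the semicircle law of variance `v` at `i t`. -/
def semicircleStieltjes (v t : ℝ) : ℝ := (√(t ^ 2 + 4 * v) - t) / (2 * v)

theorem stieltjes_im_nonneg (p : ℝ) (G : SimpleGraph V) : 0 ≤ (stieltjes p t G).im := by
  have h := im_trace_imagResolvent (centredAdj_isHermitian p G) ht
  rw [stieltjes, ← Complex.ofReal_natCast, Complex.div_ofReal_im, graphResolvent, h]
  exact div_nonneg (Finset.sum_nonneg fun _ _ => by positivity) (by positivity)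

/-- The defect factors as v(s - im)(s + im'), with m, m' ≥ 0. Since Im s ≥ 0, the second factor has
modulus at least m' ≥ t/v, so a small defect forces s towards im. -/
theorem abs_stieltjes_im_sub_le {p : ℝ} (hv : 0 < p * (1 - p)) (G : SimpleGraph V) :
    |(stieltjes p t G).im - semicircleStieltjes (p * (1 - p)) t| ≤ ‖loopDefect p t G‖ / t := by
  set v := p * (1 - p) with hvd
  set s := stieltjes p t G with hs
  set m := semicircleStieltjes v t with hm
  set r := √(t ^ 2 + 4 * v) with hr
  have hrr : r ^ 2 = t ^ 2 + 4 * v := Real.sq_sqrt (by positivity)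
  have hrt : t ≤ r := Real.le_sqrt_of_sq_le (by linarith)
  set m' := (r + t) / (2 * v) with hm'
  have h1 : m' - m = t / v := by rw [hm, hm', semicircleStieltjes, ← hr]; field_simp; ring
  have h2 : m * m' = 1 / v := by
    rw [hm, hm', semicircleStieltjes, ← hr, div_mul_div_comm]
    field_simp
    linarith
  have hF : loopDefect p t G = v * ((s - m * Complex.I) * (s + m' * Complex.I)) := by
    have h3 : v * (m' - m) = t := by rw [h1]; field_simp
    have h4 : v * (m * m') = 1 := by rw [h2]; field_simp
    have h3' : (v : ℂ) * (m' - m) = t := by exact_mod_cast congrArg Complex.ofReal h3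
    have h4' : (v : ℂ) * (m * m') = 1 := by exact_mod_cast congrArg Complex.ofReal h4
    rw [loopDefect, ← hs, ← hvd]
    linear_combination (-Complex.I * s) * h3' - h4' - (v : ℂ) * m * m' * Complex.I_mul_I * (-1)
  have h5 : t / v ≤ ‖s + m' * Complex.I‖ := by
    refine le_trans ?_ (Complex.im_le_norm _)
    have h6 : 0 ≤ s.im := stieltjes_im_nonneg ht p G
    have h7 : t / v ≤ m' := by rw [hm', div_le_div_iff₀ hv (by positivity)]; nlinarith
    simp
    linarith
  have h8 : |s.im - m| ≤ ‖s - m * Complex.I‖ := by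
    have := Complex.abs_im_le_norm (s - m * Complex.I)
    simpa using this
  rw [hF, norm_mul, norm_mul, Complex.norm_real, Real.norm_of_nonneg hv.le, le_div_iff₀ ht]
  calc |s.im - m| * t ≤ ‖s - m * Complex.I‖ * (v * (t / v)) := by
        rw [mul_div_cancel₀ _ hv.ne']; gcongr
    _ ≤ ‖s - m * Complex.I‖ * (v * ‖s + m' * Complex.I‖) := by gcongr
    _ = _ := by ring

theorem mean_abs_stieltjes_im_sub_le [Nonempty V] (hp : 0 < (p : ℝ) * (1 - p)) :
    mean (p : ℝ) (fun G : SimpleGraph V =>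
      |(stieltjes (p : ℝ) t G).im - semicircleStieltjes ((p : ℝ) * (1 - p)) t|) ≤
      t⁻¹ * √(loopConst t / √(Fintype.card V)) := by
  calc _ ≤ mean (p : ℝ) (fun G : SimpleGraph V => t⁻¹ • ‖loopDefect (p : ℝ) t G‖) :=
        mean_mono p.2.1 p.2.2 fun G => by
          rw [smul_eq_mul, inv_mul_eq_div]
          exact abs_stieltjes_im_sub_le ht hp G
    _ ≤ _ := by
        rw [mean_smul, smul_eq_mul]
        gcongr
        exact (mean_le_sqrt _).trans (Real.sqrt_le_sqrt (mean_norm_loopDefect_sq_le ht))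

end SelfConsistent

/-! ### Coulson's formula and the semicircle integral -/

section Coulson

open Set

theorem tendsto_mul_arctan_div (l : ℝ) :
    Tendsto (fun t : ℝ => |l| * Real.arctan (t / |l|)) atTop (𝓝 (|l| * (Real.pi / 2))) := by
  -- For `l = 0` the quotient `t / |l|` is the default 0, and the outer factor `|l|` vanishes
  -- anyway.
  rcases eq_or_ne l 0 with rfl | hl
  · simp
  · refine Tendsto.const_mul _ ?_
    refine (tendsto_nhds_of_tendsto_nhdsWithin Real.tendsto_arctan_atTop).comp ?_
    exact tendsto_id.atTop_div_const (abs_pos.2 hl)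

theorem hasDerivAt_mul_arctan_div (l : ℝ) {t : ℝ} (ht : 0 < t) :
    HasDerivAt (fun t : ℝ => |l| * Real.arctan (t / |l|)) (l ^ 2 / (l ^ 2 + t ^ 2)) t := by
  rcases eq_or_ne l 0 with rfl | hl
  · simpa using hasDerivAt_const t (0 : ℝ)
  · have h := (((hasDerivAt_id t).div_const |l|).arctan).const_mul |l|
    refine h.congr_deriv ?_
    have := abs_pos.2 hl
    rw [← sq_abs l]
    simp only [id]
    field_simp

theorem integrableOn_sq_div (l : ℝ) :
    IntegrableOn (fun t : ℝ => l ^ 2 / (l ^ 2 + t ^ 2)) (Ioi 0) :=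
  integrableOn_Ioi_deriv_of_nonneg (by fun_prop)
    (fun _ ht => hasDerivAt_mul_arctan_div l ht) (fun _ _ => by positivity)
    (tendsto_mul_arctan_div l)

/-- Coulson's integral formula for the absolute value. -/
theorem integral_sq_div (l : ℝ) :
    ∫ t in Ioi (0 : ℝ), l ^ 2 / (l ^ 2 + t ^ 2) = |l| * (Real.pi / 2) := by
  rw [integral_Ioi_of_hasDerivAt_of_tendsto (by fun_prop)
    (fun _ ht => hasDerivAt_mul_arctan_div l ht) (integrableOn_sq_div l) (tendsto_mul_arctan_div l)]
  simp

variable {v : ℝ} (hv : 0 < v)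

/-- An antiderivative of `1 - t * semicircleStieltjes v t`. -/
def semicirclePrimitive (v t : ℝ) : ℝ :=
  (t ^ 3 + 6 * v * t - √(t ^ 2 + 4 * v) ^ 3) / (6 * v)

include hv

/-- The rationalised form makes both positivity and the t⁻² decay visible. -/
theorem one_sub_mul_semicircleStieltjes {t : ℝ} (ht : 0 < t) :
    1 - t * semicircleStieltjes v t = 4 * v / (√(t ^ 2 + 4 * v) + t) ^ 2 := by
  set r := √(t ^ 2 + 4 * v) with hr
  have hrr : r ^ 2 = t ^ 2 + 4 * v := Real.sq_sqrt (by positivity)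
  have hr0 : 0 ≤ r := Real.sqrt_nonneg _
  rw [semicircleStieltjes, ← hr, eq_div_iff (by positivity)]
  field_simp
  linear_combination (-t * r - t ^ 2 + 2 * v) * hrr

theorem semicircle_tail_nonneg {t : ℝ} (ht : 0 < t) : 0 ≤ 1 - t * semicircleStieltjes v t := by
  rw [one_sub_mul_semicircleStieltjes hv ht]; positivity

theorem semicircle_tail_le (hv1 : v ≤ 1) {t : ℝ} (ht : 0 < t) :
    1 - t * semicircleStieltjes v t ≤ 2 * (1 + t ^ 2)⁻¹ := by
  rw [one_sub_mul_semicircleStieltjes hv ht]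
  set r := √(t ^ 2 + 4 * v) with hr
  have hrr : r ^ 2 = t ^ 2 + 4 * v := Real.sq_sqrt (by positivity)
  have hr0 : 0 ≤ r := Real.sqrt_nonneg _
  have hrt : t ≤ r := Real.le_sqrt_of_sq_le (by linarith)
  rw [← div_eq_mul_inv, div_le_div_iff₀ (by positivity) (by positivity)]
  have h1 : 4 * t ^ 2 ≤ (r + t) ^ 2 := by nlinarith
  have h2 : 4 * v ≤ (r + t) ^ 2 := by nlinarith [mul_nonneg hr0 ht.le, sq_nonneg t]
  nlinarith [sq_nonneg t]

theorem hasDerivAt_semicirclePrimitive (t : ℝ) :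
    HasDerivAt (semicirclePrimitive v) (1 - t * semicircleStieltjes v t) t := by
  have hpos : 0 < t ^ 2 + 4 * v := by positivity
  have h1 : HasDerivAt (fun t : ℝ => √(t ^ 2 + 4 * v)) (2 * t / (2 * √(t ^ 2 + 4 * v))) t := by
    have := ((hasDerivAt_pow 2 t).add_const (4 * v)).sqrt hpos.ne'
    simpa using this
  have h2 := ((((hasDerivAt_pow 3 t).add ((hasDerivAt_id t).const_mul (6 * v))).sub
    (h1.pow 3)).div_const (6 * v))
  refine h2.congr_deriv ?_
  have hs := Real.sqrt_pos.2 hpos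
  rw [semicircleStieltjes]
  push_cast
  field_simp
  ring

theorem tendsto_semicirclePrimitive :
    Tendsto (semicirclePrimitive v) atTop (𝓝 0) := by
  have h1 : ∀ t : ℝ, 0 < t → ‖semicirclePrimitive v t‖ ≤ (2 * v + 32 * v ^ 2 / 3) * (t⁻¹ + (t ^ 3)⁻¹) := by
    intro t ht
    set r := √(t ^ 2 + 4 * v) with hr
    have hrr : r ^ 2 = t ^ 2 + 4 * v := Real.sq_sqrt (by positivity)
    have hr0 : 0 ≤ r := Real.sqrt_nonneg _
    -- Multiplying by the conjugate cancels the leading terms: (t³ + 6vt)² - (t² + 4v)³ = -(12v²t² +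
    -- 64v³).
    have e : semicirclePrimitive v t =
        -((2 * v * t ^ 2 + 32 * v ^ 2 / 3) / (t ^ 3 + 6 * v * t + r ^ 3)) := by
      rw [semicirclePrimitive, ← hr, ← neg_div, div_eq_div_iff (by positivity) (by positivity)]
      have h6 : r ^ 6 = (t ^ 2 + 4 * v) ^ 3 := by rw [← hrr]; ring
      linear_combination -h6
    rw [e, norm_neg, Real.norm_of_nonneg (by positivity)]
    calc _ ≤ (2 * v * t ^ 2 + 32 * v ^ 2 / 3) / t ^ 3 := by
          gcongr
          have : 0 ≤ 6 * v * t + r ^ 3 := by positivity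
          linarith
      _ = 2 * v * t⁻¹ + 32 * v ^ 2 / 3 * (t ^ 3)⁻¹ := by field_simp
      _ ≤ _ := by
          have h3 : 0 ≤ 2 * v * (t ^ 3)⁻¹ := by positivity
          have h4 : 0 ≤ 32 * v ^ 2 / 3 * t⁻¹ := by positivity
          linarith
  refine squeeze_zero_norm' ((eventually_gt_atTop 0).mono h1) ?_
  have h2 : Tendsto (fun t : ℝ => (t ^ 3)⁻¹) atTop (𝓝 0) :=
    tendsto_inv_atTop_zero.comp (tendsto_pow_atTop (by norm_num))
  simpa using (tendsto_inv_atTop_zero.add h2).const_mul (2 * v + 32 * v ^ 2 / 3)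

theorem integrableOn_semicircle_tail :
    IntegrableOn (fun t => 1 - t * semicircleStieltjes v t) (Ioi 0) :=
  integrableOn_Ioi_deriv_of_nonneg (hasDerivAt_semicirclePrimitive hv 0).continuousAt.continuousWithinAt
    (fun t _ => hasDerivAt_semicirclePrimitive hv t) (fun _ ht => semicircle_tail_nonneg hv ht)
    (tendsto_semicirclePrimitive hv)

theorem integral_semicircle_tail :
    ∫ t in Ioi (0 : ℝ), (1 - t * semicircleStieltjes v t) = 4 / 3 * √v := by
  rw [integral_Ioi_of_hasDerivAt_of_tendsto
    (hasDerivAt_semicirclePrimitive hv 0).continuousAt.continuousWithinAt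
    (fun t _ => hasDerivAt_semicirclePrimitive hv t) (integrableOn_semicircle_tail hv)
    (tendsto_semicirclePrimitive hv)]
  have h4 : √(4 * v) = 2 * √v := by
    rw [Real.sqrt_mul (by norm_num), show (4 : ℝ) = 2 ^ 2 by norm_num, Real.sqrt_sq (by norm_num)]
  have hs : √v ^ 2 = v := Real.sq_sqrt hv.le
  simp only [semicirclePrimitive, ne_eq, OfNat.ofNat_ne_zero, not_false_eq_true, zero_pow, mul_zero,
    add_zero, zero_add, zero_sub, h4]
  field_simp
  linear_combination 24 * hs

end Coulson

/-! ### Convergence of the normalised energy in mean -/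

section EnergyLimit

open Set

variable {V : Type*} [Fintype V] [DecidableEq V]

/-- The average of `λ² / (λ² + t²)` over the eigenvalues `λ`. -/
def spectralTail {X : Matrix V V ℝ} (hX : X.IsHermitian) (t : ℝ) : ℝ :=
  (∑ k, hX.eigenvalues k ^ 2 / (hX.eigenvalues k ^ 2 + t ^ 2)) / Fintype.card V

theorem sum_eigenvalues_sq {X : Matrix V V ℝ} (hX : X.IsHermitian) :
    ∑ k, hX.eigenvalues k ^ 2 = ∑ i, ∑ j, X i j ^ 2 := by
  have h1 : X = (hX.eigenvectorUnitary : Matrix V V ℝ) * Matrix.diagonal hX.eigenvalues *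
      star (hX.eigenvectorUnitary : Matrix V V ℝ) := by
    conv_lhs => rw [hX.spectral_theorem]
    rw [Unitary.conjStarAlgAut_apply]; rfl
  have h2 : (X * X).trace = ∑ i, ∑ j, X i j ^ 2 := by
    simp only [Matrix.trace, Matrix.diag_apply, Matrix.mul_apply]
    refine Finset.sum_congr rfl fun i _ => Finset.sum_congr rfl fun j _ => ?_
    have := hX.apply i j
    simp only [star_trivial] at this
    rw [this, sq]
  have h3 := Unitary.star_mul_self_of_mem hX.eigenvectorUnitary.2
  rw [← h2]
  set U : Matrix V V ℝ := (hX.eigenvectorUnitary : Matrix V V ℝ)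
  set D := Matrix.diagonal hX.eigenvalues with hD
  have h4 : X * X = U * (D * D) * star U := by
    calc X * X = U * D * (star U * U) * D * star U := by
          conv_lhs => rw [h1]
          noncomm_ring
      _ = _ := by rw [h3]; noncomm_ring
  rw [h4, Matrix.trace_mul_cycle, h3, one_mul, hD, Matrix.diagonal_mul_diagonal,
    Matrix.trace_diagonal]
  simp [sq]

theorem integrableOn_spectralTail {X : Matrix V V ℝ} (hX : X.IsHermitian) :
    IntegrableOn (spectralTail hX) (Ioi 0) := by
  refine Integrable.div_const (integrable_finsetSum _ fun k _ => ?_) _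
  exact integrableOn_sq_div _

theorem integral_spectralTail {X : Matrix V V ℝ} (hX : X.IsHermitian) :
    ∫ t in Ioi (0 : ℝ), spectralTail hX t = energy X hX / Fintype.card V * (Real.pi / 2) := by
  simp only [spectralTail]
  rw [integral_div, integral_finsetSum _ fun k _ => integrableOn_sq_div _]
  simp only [integral_sq_div, ← Finset.sum_mul, energy]
  ring

theorem spectralTail_nonneg {X : Matrix V V ℝ} (hX : X.IsHermitian) (t : ℝ) :
    0 ≤ spectralTail hX t :=
  div_nonneg (Finset.sum_nonneg fun _ _ => by positivity) (by positivity)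

theorem measurable_spectralTail {X : Matrix V V ℝ} (hX : X.IsHermitian) :
    Measurable (spectralTail hX) := by
  unfold spectralTail; fun_prop

/-- Each summand is at most 1 and also at most λ²/t², and Σ λ² ≤ n is the Frobenius norm bound.
Adding the two estimates gives a dominating function independent of n and of the matrix. -/
theorem spectralTail_le {X : Matrix V V ℝ} (hX : X.IsHermitian)
    (h : ∀ i j, X i j ^ 2 ≤ 1 / Fintype.card V) {t : ℝ} (ht : 0 < t) :
    spectralTail hX t ≤ 2 * (1 + t ^ 2)⁻¹ := by
  rcases isEmpty_or_nonempty V with hV | hV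
  · simp [spectralTail]; positivity
  have hn : (0 : ℝ) < Fintype.card V := by exact_mod_cast Fintype.card_pos
  have h1 : spectralTail hX t ≤ 1 := by
    rw [spectralTail, div_le_one hn]
    calc _ ≤ ∑ k : V, (1 : ℝ) := Finset.sum_le_sum fun k _ => by
          rw [div_le_one (by positivity)]; nlinarith
      _ = _ := by simp
  have h2 : spectralTail hX t * t ^ 2 ≤ 1 := by
    rw [spectralTail, div_mul_eq_mul_div, div_le_one hn, Finset.sum_mul]
    calc _ ≤ ∑ k, hX.eigenvalues k ^ 2 := Finset.sum_le_sum fun k _ => by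
          rw [div_mul_eq_mul_div, div_le_iff₀ (by positivity)]
          nlinarith [sq_nonneg (hX.eigenvalues k), mul_self_nonneg (hX.eigenvalues k ^ 2)]
      _ ≤ ∑ i : V, ∑ j : V, (1 / Fintype.card V : ℝ) := by
          rw [sum_eigenvalues_sq]
          exact Finset.sum_le_sum fun i _ => Finset.sum_le_sum fun j _ => h i j
      _ = _ := by simp
  rw [← div_eq_mul_inv, le_div_iff₀ (by positivity)]
  linarith

theorem centredAdj_sq_le (p : unitInterval) (G : SimpleGraph V) (i j : V) :
    centredAdj (p : ℝ) G i j ^ 2 ≤ 1 / Fintype.card V := by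
  classical
  have h0 := p.2.1
  have h1 := p.2.2
  rw [centredAdj, Matrix.of_apply]
  split_ifs
  · simp
  all_goals
    rw [div_pow, Real.sq_sqrt (by positivity)]
    gcongr
    nlinarith

theorem spectralTail_centredAdj [Nonempty V] (p : ℝ) (G : SimpleGraph V) {t : ℝ} (ht : 0 < t) :
    spectralTail (centredAdj_isHermitian p G) t = 1 - t * (stieltjes p t G).im := by
  have hn : (Fintype.card V : ℝ) ≠ 0 := by exact_mod_cast Fintype.card_ne_zero
  rw [stieltjes, ← Complex.ofReal_natCast, Complex.div_ofReal_im, graphResolvent,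
    im_trace_imagResolvent (centredAdj_isHermitian p G) ht, spectralTail, eq_sub_iff_add_eq,
    ← mul_div_assoc, ← add_div, Finset.mul_sum, ← Finset.sum_add_distrib, div_eq_one_iff_eq hn]
  calc _ = ∑ k : V, (1 : ℝ) := Finset.sum_congr rfl fun k _ => by
        have : (centredAdj_isHermitian p G).eigenvalues k ^ 2 + t ^ 2 ≠ 0 := by positivity
        field_simp
    _ = _ := by simp

/-- The expected distance of the spectral tail from that of the semicircle law. -/
def meanTailError (V : Type*) [Fintype V] [DecidableEq V] (p : unitInterval) (t : ℝ) : ℝ :=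
  mean (p : ℝ) (fun G : SimpleGraph V => |spectralTail (centredAdj_isHermitian (p : ℝ) G) t -
    (1 - t * semicircleStieltjes ((p : ℝ) * (1 - p)) t)|)

variable {p : unitInterval} (hp : 0 < (p : ℝ) * (1 - p))

include hp

theorem meanTailError_le_sqrt [Nonempty V] {t : ℝ} (ht : 0 < t) :
    meanTailError V p t ≤ √(loopConst t / √(Fintype.card V)) := by
  calc meanTailError V p t = t * mean (p : ℝ) (fun G : SimpleGraph V =>
      |(stieltjes (p : ℝ) t G).im - semicircleStieltjes ((p : ℝ) * (1 - p)) t|) := by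
        rw [← smul_eq_mul, ← mean_smul, meanTailError]
        congr 1; ext G
        rw [spectralTail_centredAdj _ _ ht, smul_eq_mul, ← abs_of_pos ht, ← abs_mul, abs_of_pos ht,
          abs_sub_comm]
        congr 1; ring
    _ ≤ t * (t⁻¹ * √(loopConst t / √(Fintype.card V))) := by
        gcongr; exact mean_abs_stieltjes_im_sub_le ht hp
    _ = _ := by field_simp

theorem meanTailError_le {t : ℝ} (ht : 0 < t) : meanTailError V p t ≤ 2 * (1 + t ^ 2)⁻¹ := by
  rw [← mean_const (V := V) p (2 * (1 + t ^ 2)⁻¹)]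
  refine mean_mono p.2.1 p.2.2 fun G => ?_
  have h1 := spectralTail_le (centredAdj_isHermitian (p : ℝ) G) (centredAdj_sq_le p G) ht
  have h2 := semicircle_tail_le hp (unitInterval_mul_one_sub_le_one p) ht
  have h3 := spectralTail_nonneg (centredAdj_isHermitian (p : ℝ) G) t
  have h4 := semicircle_tail_nonneg hp ht
  rw [abs_le]; constructor <;> linarith

omit hp in
theorem meanTailError_nonneg (t : ℝ) : 0 ≤ meanTailError V p t :=
  mean_nonneg p.2.1 p.2.2 fun _ => abs_nonneg _

omit hp in
theorem measurable_meanTailError : Measurable (meanTailError V p) := by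
  unfold meanTailError mean semicircleStieltjes
  refine Finset.measurable_sum _ fun G _ => ?_
  have := measurable_spectralTail (centredAdj_isHermitian (p : ℝ) G)
  fun_prop

theorem mean_abs_energy_sub_le :
    mean (p : ℝ) (fun G : SimpleGraph V =>
      |energy (centredAdj (p : ℝ) G) (centredAdj_isHermitian (p : ℝ) G) / Fintype.card V -
        8 / (3 * Real.pi) * √((p : ℝ) * (1 - p))|) ≤
      2 / Real.pi * ∫ t in Ioi (0 : ℝ), meanTailError V p t := by
  have hint : ∀ G : SimpleGraph V, IntegrableOn (fun t =>
      |spectralTail (centredAdj_isHermitian (p : ℝ) G) t -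
        (1 - t * semicircleStieltjes ((p : ℝ) * (1 - p)) t)|) (Ioi 0) := fun G =>
    ((integrableOn_spectralTail _).sub (integrableOn_semicircle_tail hp)).abs
  have e : ∫ t in Ioi (0 : ℝ), meanTailError V p t = mean (p : ℝ) (fun G : SimpleGraph V =>
      ∫ t in Ioi (0 : ℝ), |spectralTail (centredAdj_isHermitian (p : ℝ) G) t -
        (1 - t * semicircleStieltjes ((p : ℝ) * (1 - p)) t)|) := by
    simp only [meanTailError, mean, smul_eq_mul]
    exact (integral_finsetSum _ fun G _ => (hint G).const_mul _).trans
      (by simp only [integral_const_mul])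
  rw [e, ← smul_eq_mul (2 / Real.pi), ← mean_smul]
  refine mean_mono p.2.1 p.2.2 fun G => ?_
  -- Both terms are (2/π) times a tail integral; for the semicircle it is (2/π)(4/3)√v = 8/(3π) √v.
  have h1 : energy (centredAdj (p : ℝ) G) (centredAdj_isHermitian (p : ℝ) G) / Fintype.card V -
        8 / (3 * Real.pi) * √((p : ℝ) * (1 - p)) =
      2 / Real.pi * ∫ t in Ioi (0 : ℝ), (spectralTail (centredAdj_isHermitian (p : ℝ) G) t -
        (1 - t * semicircleStieltjes ((p : ℝ) * (1 - p)) t)) := by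
    rw [integral_sub (integrableOn_spectralTail _) (integrableOn_semicircle_tail hp),
      integral_spectralTail, integral_semicircle_tail hp]
    field_simp
    ring
  rw [h1, abs_mul, abs_of_nonneg (by positivity : 0 ≤ 2 / Real.pi), smul_eq_mul]
  gcongr
  exact abs_integral_le_integral_abs

/-- The normalised energy of the centred adjacency matrix converges in mean. -/
theorem tendsto_mean_abs_energy_sub :
    Tendsto (fun n : ℕ => mean (p : ℝ) (fun G : SimpleGraph (Fin n) =>
      |energy (centredAdj (p : ℝ) G) (centredAdj_isHermitian (p : ℝ) G) / n -
        8 / (3 * Real.pi) * √((p : ℝ) * (1 - p))|)) atTop (𝓝 0) := by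
  have h1 : Tendsto (fun n : ℕ => ∫ t in Ioi (0 : ℝ), meanTailError (Fin n) p t) atTop
      (𝓝 (∫ t in Ioi (0 : ℝ), (0 : ℝ))) := by
    -- The moment bound degenerates as t → 0, so it serves only for pointwise convergence; the
    -- uniform bound supplies the domination.
    refine tendsto_integral_filter_of_dominated_convergence (fun t : ℝ => 2 * (1 + t ^ 2)⁻¹)
      (Eventually.of_forall fun n => measurable_meanTailError.aestronglyMeasurable)
      (Eventually.of_forall fun n => ?_) (integrable_inv_one_add_sq.const_mul 2).integrableOn ?_
    · filter_upwards [ae_restrict_mem measurableSet_Ioi] with t ht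
      rw [Real.norm_of_nonneg (meanTailError_nonneg t)]
      exact meanTailError_le hp ht
    · filter_upwards [ae_restrict_mem measurableSet_Ioi] with t ht
      have h2 : Tendsto (fun n : ℕ => √(loopConst t / √(n : ℝ))) atTop (𝓝 0) := by
        have h3 : Tendsto (fun n : ℕ => √(n : ℝ)) atTop atTop :=
          Real.tendsto_sqrt_atTop.comp tendsto_natCast_atTop_atTop
        have := (h3.const_div_atTop (loopConst t)).sqrt
        simpa using this
      refine squeeze_zero' (Eventually.of_forall fun n => meanTailError_nonneg t) ?_ h2
      filter_upwards [eventually_ge_atTop 1] with n hn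
      have : Nonempty (Fin n) := ⟨⟨0, hn⟩⟩
      simpa using meanTailError_le_sqrt (V := Fin n) hp ht
  have h2 := h1.const_mul (2 / Real.pi)
  simp only [integral_zero, mul_zero] at h2
  refine squeeze_zero (fun n => mean_nonneg p.2.1 p.2.2 fun _ => abs_nonneg _) (fun n => ?_) h2
  simpa using mean_abs_energy_sub_le (V := Fin n) hp

end EnergyLimit

/-! ### Common neighbours and reduction to the centred adjacency matrix -/

section Diameter

variable {V : Type*}

/-- The graphs in which any two distinct vertices have a common neighbour. -/
def commonNeighborGraphs (V : Type*) : Set (SimpleGraph V) :=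
  {G | ∀ i j, i ≠ j → ∃ k, G.Adj i k ∧ G.Adj j k}

theorem dist_eq_two_of_common_neighbor {G : SimpleGraph V} {i j k : V} (hij : i ≠ j)
    (h : ¬ G.Adj i j) (hi : G.Adj i k) (hj : G.Adj j k) : G.dist i j = 2 := by
  have h1 : G.dist i j ≤ 2 := dist_le (Walk.cons hi (Walk.cons hj.symm Walk.nil))
  have h2 : G.Reachable i j := ⟨Walk.cons hi (Walk.cons hj.symm Walk.nil)⟩
  have h3 : G.dist i j ≠ 0 := fun h0 => hij (h2.dist_eq_zero_iff.1 h0)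
  have h4 : G.dist i j ≠ 1 := fun h0 => h (dist_eq_one_iff_adj.1 h0)
  omega

variable [Fintype V] [DecidableEq V]

/-- Off the diagonal the entry is 1 on edges and 3 on non-edges, that is 3 - 2a = (3 - 2p) - 2(a -
p) with a the adjacency indicator. -/
theorem hyperWienerMatrix_eq (p : ℝ) {G : SimpleGraph V} (hG : G ∈ commonNeighborGraphs V) :
    hyperWienerMatrix G = (-2 * √(Fintype.card V)) • centredAdj p G +
      (3 - 2 * p) • (Matrix.of (fun _ _ => (1 : ℝ)) - 1 : Matrix V V ℝ) := by
  classical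
  ext i j
  have hn : √(Fintype.card V : ℝ) ≠ 0 := by
    have : 0 < Fintype.card V := Fintype.card_pos_iff.2 ⟨i⟩
    positivity
  by_cases hij : i = j
  · subst hij
    simp [hyperWienerMatrix, centredAdj]
  · obtain ⟨k, hi, hj⟩ := hG i j hij
    by_cases h : G.Adj i j
    · simp [hyperWienerMatrix, centredAdj, hij, h, dist_eq_one_iff_adj.2 h]
      field_simp
      ring
    · simp [hyperWienerMatrix, centredAdj, hij, h, dist_eq_two_of_common_neighbor hij h hi hj]
      field_simp
      ring

theorem abs_hyperWienerEnergy_sub_le (p : unitInterval) [Nonempty V] {G : SimpleGraph V}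
    (hG : G ∈ commonNeighborGraphs V) :
    |hyperWienerEnergy G - 2 * √(Fintype.card V) *
      energy (centredAdj (p : ℝ) G) (centredAdj_isHermitian (p : ℝ) G)| ≤ 6 * Fintype.card V := by
  have hn : 0 < √(Fintype.card V : ℝ) := Real.sqrt_pos.2 (by exact_mod_cast Fintype.card_pos)
  have h := abs_energy_sub_le (hyperWienerMatrix_isHermitian G)
    (centredAdj_isHermitian (p : ℝ) G) (by nlinarith) (hyperWienerMatrix_eq (p : ℝ) hG)
    (sum_abs_quadForm_allOnes_sub_one_le _)
  have h1 : |-2 * √(Fintype.card V : ℝ)| = 2 * √(Fintype.card V) := by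
    rw [neg_mul, abs_neg, abs_of_pos (by positivity)]
  rw [h1] at h
  refine h.trans ?_
  have h2 : |3 - 2 * (p : ℝ)| ≤ 3 := by
    rw [abs_le]; constructor <;> linarith [p.2.1, p.2.2]
  calc _ ≤ 3 * (2 * (Fintype.card V : ℝ)) := by gcongr
    _ = _ := by ring

/-- Union bound over ordered pairs; the exponent counts the vertices other than i and j. -/
theorem mean_indicator_compl_commonNeighborGraphs_le (p : unitInterval) :
    mean (p : ℝ) ((commonNeighborGraphs V)ᶜ.indicator fun _ => (1 : ℝ)) ≤
      (Fintype.card V : ℝ) ^ 2 * (1 - (p : ℝ) ^ 2) ^ (Fintype.card V - 2) := by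
  classical
  set q : V → V → SimpleGraph V → ℝ := fun i j G => if i = j then 0 else
    ∏ k ∈ (Finset.univ.erase i).erase j, {G : SimpleGraph V | ¬ (G.Adj i k ∧ G.Adj j k)}.indicator
      (fun _ => (1 : ℝ)) G with hq
  have hq0 : ∀ i j G, 0 ≤ q i j G := by
    intro i j G
    simp only [hq]
    split_ifs
    · exact le_rfl
    · exact Finset.prod_nonneg fun k _ => Set.indicator_nonneg (fun _ _ => zero_le_one) _
  have h0 : 0 ≤ 1 - (p : ℝ) ^ 2 := by nlinarith [p.2.1, p.2.2]
  have hmean : ∀ i j, mean (p : ℝ) (q i j) ≤ (1 - (p : ℝ) ^ 2) ^ (Fintype.card V - 2) := by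
    intro i j
    by_cases hij : i = j
    · simp only [hq, if_pos hij, mean_const]; positivity
    · simp only [hq, if_neg hij]
      rw [mean_prod_no_common_neighbor p hij _ (by simp) (by simp),
        Finset.card_erase_of_mem (by simp [Ne.symm hij]), Finset.card_erase_of_mem (by simp),
        Finset.card_univ, Nat.sub_sub]
  calc _ ≤ mean (p : ℝ) (fun G => ∑ i, ∑ j, q i j G) := by
        refine mean_mono p.2.1 p.2.2 fun G => Set.indicator_le' (fun G hG => ?_)
          (fun G _ => Finset.sum_nonneg fun i _ => Finset.sum_nonneg fun j _ => hq0 i j G) G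
        simp only [commonNeighborGraphs, Set.mem_compl_iff, Set.mem_ofPred_eq, not_forall,
          not_exists] at hG
        obtain ⟨i, j, hij, h⟩ := hG
        have h1 : q i j G = 1 := by
          simp only [hq, if_neg hij]
          exact Finset.prod_eq_one fun k _ => Set.indicator_of_mem (h k) _
        rw [← h1]
        exact (Finset.single_le_sum (f := fun j => q i j G) (fun j _ => hq0 i j G)
          (Finset.mem_univ j)).trans (Finset.single_le_sum (f := fun i => ∑ j, q i j G)
          (fun i _ => Finset.sum_nonneg fun j _ => hq0 i j G) (Finset.mem_univ i))
    _ = ∑ i, ∑ j, mean (p : ℝ) (q i j) := by simp only [mean_sum]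
    _ ≤ ∑ i : V, ∑ j : V, (1 - (p : ℝ) ^ 2) ^ (Fintype.card V - 2) :=
        Finset.sum_le_sum fun i _ => Finset.sum_le_sum fun j _ => hmean i j
    _ = _ := by simp; ring

theorem tendsto_mean_indicator_compl_commonNeighborGraphs {p : unitInterval} (hp : 0 < p) :
    Tendsto (fun n : ℕ => mean (p : ℝ)
      ((commonNeighborGraphs (Fin n))ᶜ.indicator fun _ => (1 : ℝ))) atTop (𝓝 0) := by
  have hp' : (0 : ℝ) < p := hp
  -- Shifting n by 2 removes the truncated subtraction in the exponent.
  have h1 : Tendsto (fun n : ℕ => (((n + 2 : ℕ) : ℝ)) ^ 2 * (1 - (p : ℝ) ^ 2) ^ n) atTop (𝓝 0) := by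
    have hr0 : 0 ≤ 1 - (p : ℝ) ^ 2 := by nlinarith [p.2.1, p.2.2]
    have hr1 : 1 - (p : ℝ) ^ 2 < 1 := by nlinarith
    have e : ∀ n : ℕ, (((n + 2 : ℕ) : ℝ)) ^ 2 * (1 - (p : ℝ) ^ 2) ^ n =
        (n : ℝ) ^ 2 * (1 - (p : ℝ) ^ 2) ^ n + 4 * ((n : ℝ) ^ 1 * (1 - (p : ℝ) ^ 2) ^ n) +
          4 * (1 - (p : ℝ) ^ 2) ^ n := fun n => by push_cast; ring
    simp only [e]
    simpa using ((tendsto_pow_const_mul_const_pow_of_lt_one 2 hr0 hr1).add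
      ((tendsto_pow_const_mul_const_pow_of_lt_one 1 hr0 hr1).const_mul 4)).add
      ((tendsto_pow_atTop_nhds_zero_of_lt_one hr0 hr1).const_mul 4)
  rw [← tendsto_add_atTop_iff_nat 2]
  refine squeeze_zero (fun n => mean_nonneg p.2.1 p.2.2 fun G =>
    Set.indicator_nonneg (fun _ _ => zero_le_one) _) (fun n => ?_) h1
  simpa using mean_indicator_compl_commonNeighborGraphs_le (V := Fin (n + 2)) p

/-- The allowance ε n^(3/2) is split in half: 12 ≤ ε√n absorbs the perturbation 6n, and ε/4 is
doubled by the factor 2√n in front of X. -/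
theorem abs_hyperWienerEnergy_sub_limit_le (p : unitInterval) {ε c : ℝ} [Nonempty V]
    (hn : 12 ≤ ε * √(Fintype.card V)) {G : SimpleGraph V} (hG : G ∈ commonNeighborGraphs V)
    (h : |energy (centredAdj (p : ℝ) G) (centredAdj_isHermitian (p : ℝ) G) / Fintype.card V - c|
      ≤ ε / 4) :
    |hyperWienerEnergy G - 2 * c * (Fintype.card V : ℝ) ^ (3 / 2 : ℝ)| ≤
      ε * (Fintype.card V : ℝ) ^ (3 / 2 : ℝ) := by
  have h1 := abs_hyperWienerEnergy_sub_le p hG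
  set n : ℝ := (Fintype.card V : ℝ) with hnd
  have hn0 : 0 < n := by rw [hnd]; exact_mod_cast Fintype.card_pos
  have hpow : n ^ (3 / 2 : ℝ) = n * √n := by
    rw [show (3 / 2 : ℝ) = 1 + 1 / 2 by norm_num, Real.rpow_add hn0, Real.rpow_one,
      Real.sqrt_eq_rpow]
  set e := energy (centredAdj (p : ℝ) G) (centredAdj_isHermitian (p : ℝ) G)
  rw [hpow]
  have h2 : hyperWienerEnergy G - 2 * c * (n * √n) =
      (hyperWienerEnergy G - 2 * √n * e) + 2 * (n * √n) * (e / n - c) := by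
    field_simp; ring
  rw [h2]
  have h3 : 12 * n ≤ ε * √n * n := by gcongr
  calc _ ≤ 6 * n + 2 * (n * √n) * (ε / 4) := by
        refine (abs_add_le _ _).trans (add_le_add h1 ?_)
        rw [abs_mul, abs_of_nonneg (by positivity : 0 ≤ 2 * (n * √n))]
        gcongr
    _ ≤ _ := by linarith

end Diameter

end HyperWiener

end

/-! ### Conclusion by Markov's inequality -/

/-- `SimpleGraph.binomialRandom (Fin n) p` is the law of the random graph on `n` labelled vertices
whose edges are present independently with probability `p`. -/
theorem corollary3p3 (p : unitInterval) (hp0 : 0 < p) (hp1 : p < 1) (ε : ℝ) (hε : 0 < ε) :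
    Tendsto
      (fun n : ℕ =>
        SimpleGraph.binomialRandom (Fin n) p
          {G : SimpleGraph (Fin n) |
            |HyperWiener.hyperWienerEnergy G
                - 16 / (3 * Real.pi) * Real.sqrt ((p : ℝ) * (1 - (p : ℝ))) * (n : ℝ) ^ (3 / 2 : ℝ)|
              ≤ ε * (n : ℝ) ^ (3 / 2 : ℝ)})
      atTop (𝓝 1) := by
  have hp : 0 < (p : ℝ) * (1 - p) := mul_pos hp0 (sub_pos.2 hp1)
  set c : ℝ := 8 / (3 * Real.pi) * √((p : ℝ) * (1 - p)) with hc
  have hcc : 16 / (3 * Real.pi) * √((p : ℝ) * (1 - p)) = 2 * c := by rw [hc]; ring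
  rw [hcc]
  set S : ∀ n : ℕ, Set (SimpleGraph (Fin n)) := fun n =>
    {G | |HyperWiener.hyperWienerEnergy G - 2 * c * (n : ℝ) ^ (3 / 2 : ℝ)| ≤
      ε * (n : ℝ) ^ (3 / 2 : ℝ)} with hS
  have hlim := (HyperWiener.tendsto_mean_indicator_compl_commonNeighborGraphs hp0).add
    ((HyperWiener.tendsto_mean_abs_energy_sub hp).const_mul (4 / ε))
  have hlow := hlim.const_sub 1
  simp only [mul_zero, add_zero, sub_zero, ← hc] at hlow
  have hreal : Tendsto (fun n => (SimpleGraph.binomialRandom (Fin n) p).real (S n)) atTop (𝓝 1) := by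
    refine tendsto_of_tendsto_of_tendsto_of_le_of_le' hlow tendsto_const_nhds ?_
      (Eventually.of_forall fun n => measureReal_le_one)
    have hsq : Tendsto (fun n : ℕ => ε * √(n : ℝ)) atTop atTop :=
      (Real.tendsto_sqrt_atTop.comp tendsto_natCast_atTop_atTop).const_mul_atTop hε
    filter_upwards [hsq.eventually_ge_atTop 12, eventually_ge_atTop 1] with n hn hn1
    have : Nonempty (Fin n) := ⟨⟨0, hn1⟩⟩
    -- Union bound and Markov's inequality together reduce to the pointwise inequality 1 ≤ 1_S +
    -- (1_{Cᶜ} + (4/ε) d), where C is the common neighbour event and d the deviation of the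
    -- normalised energy.
    rw [HyperWiener.binomialRandom_real_eq_mean, sub_le_iff_le_add, ← smul_eq_mul (4 / ε),
      ← HyperWiener.mean_smul, ← HyperWiener.mean_add, ← HyperWiener.mean_add]
    refine (HyperWiener.mean_const (V := Fin n) p (1 : ℝ)).symm.le.trans ?_
    refine HyperWiener.mean_mono p.2.1 p.2.2 fun G => ?_
    have hS0 : 0 ≤ (S n).indicator (fun _ => (1 : ℝ)) G :=
      Set.indicator_nonneg (fun _ _ => zero_le_one) _
    have hC0 : 0 ≤ (HyperWiener.commonNeighborGraphs (Fin n))ᶜ.indicator (fun _ => (1 : ℝ)) G :=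
      Set.indicator_nonneg (fun _ _ => zero_le_one) _
    set d := |HyperWiener.energy (HyperWiener.centredAdj (p : ℝ) G)
      (HyperWiener.centredAdj_isHermitian (p : ℝ) G) / n - c| with hd
    have hd0 : 0 ≤ (4 / ε) • d := smul_nonneg (by positivity) (abs_nonneg _)
    by_cases hG : G ∈ HyperWiener.commonNeighborGraphs (Fin n)
    · by_cases hdε : d ≤ ε / 4
      · have hmem : G ∈ S n := by
          have := HyperWiener.abs_hyperWienerEnergy_sub_limit_le p (c := c) (ε := ε)
            (by simpa using hn) hG (by simpa using hdε)
          simpa [hS] using this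
        rw [Set.indicator_of_mem hmem] at hS0 ⊢
        linarith
      · have : 1 ≤ (4 / ε) • d := by
          rw [smul_eq_mul, div_mul_eq_mul_div, le_div_iff₀ hε]
          linarith
        linarith
    · rw [Set.indicator_of_mem (s := (HyperWiener.commonNeighborGraphs (Fin n))ᶜ) hG] at hC0 ⊢
      linarith
  rw [← ENNReal.tendsto_toReal_iff (fun n => measure_ne_top _ _) ENNReal.one_ne_top]
  simpa [measureReal_def] using hreal
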